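/- Fix a universe of small sets. A *site* is a locally small category with a Grothendieck topology; it is *small generated* if there is a small set of objects such that every object has a covering sieve all of whose arrows factor through objects of this set (every small site is small generated). For a site $(\mathcal C,J)$ let $\widehat{\mathcal C}$ be the category of presheaves of small sets, $y:\mathcal C\to\widehat{\mathcal C}$ the Yoneda embedding, $\mathrm{Sh}(\mathcal C,J)$ the category of sheaves of small sets, $i_J:\mathrm{Sh}(\mathcal C,J)\hookrightarrow\widehat{\mathcal C}$ the inclusion, and $a_J\dashv i_J$ sheafification (which exists when the site is small generated). A *distributor* $H:\mathcal C⇸\mathcal D$ is a functor $\mathcal D^{op}\times\mathcal C\to\mathbf{Set}$; write $\widehat H:\mathcal C\to\widehat{\mathcal D}$, $c\mapsto H(-,c)$. A *distributor of sites* $(\mathcal C,J)⇸(\mathcal D,K)$ is a distributor $H$ such that: - (cover-distribution) for all $x\in H(d,c)$ and every $J$-covering sieve $S$ on $c$, the sieve of all $v:d'\to d$ such that $H(v,c)(x)=H(d',u)(x')$ for some $u:c'\to c$ in $S$ and $x'\in H(d',c')$ is $K$-covering; - ($K$-flatness, 1) for all $d$ the sieve $\{v:d'\to d\mid \exists c,\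 H(d',c)\neq\emptyset\}$ is $K$-covering; - ($K$-flatness, 2) for all $x\in H(d,c)$, $x'\in H(d,c')$, the sieve of all $v:d'\to d$ for which there are $u:c''\to c$, $u':c''\to c'$, $x''\in H(d',c'')$ with $H(d',u)(x'')=H(v,c)(x)$ and $H(d',u')(x'')=H(v,c')(x')$ is $K$-covering; - ($K$-flatness, 3) for all $u,u':c'\rightrightarrows c$ and $x\in H(d,c')$ with $H(d,u)(x)=H(d,u')(x)$, the sieve of all $v:d'\to d$ for which there are $w:c''\to c'$ and $x'\in H(d',c'')$ with $uw=u'w$ and $H(d',w)(x')=H(v,c')(x)$ is $K$-covering. Let $\mathbf{Site}[(\mathcal C,J),(\mathcal D,K)]$ be the category of distributors of sites and all natural transformations between them. Let $\mathbf{Top}[\mathrm{Sh}(\mathcal D,K),\mathrm{Sh}(\mathcal C,J)]$ be the category of geometric morphisms $f=(f^*\dashv f_*)$ from $\mathrm{Sh}(\mathcal D,K)$ to $\mathrm{Sh}(\mathcal C,J)$ (so $f^*:\mathrm{Sh}(\mathcal C,J)\to\mathrm{Sh}(\mathcal D,K)$ preserves finite limits), whose morphisms $f\Rightarrow g$ are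 the natural transformations $f^*\Rightarrow g^*$. **Proposition.** Let $(\mathcal C,J)$ and $(\mathcal D,K)$ be small generated sites. 1. For every geometric morphism $f:\mathrm{Sh}(\mathcal D,K)\to\mathrm{Sh}(\mathcal C,J)$, the distributor $H_f(d,c)=f^*(a_J\,y(c))(d)$ is a distributor of sites $(\mathcal C,J)⇸(\mathcal D,K)$. Hence $f\mapsto H_f$ defines a functor $\mathbb H:\mathbf{Top}[\mathrm{Sh}(\mathcal D,K),\mathrm{Sh}(\mathcal C,J)]\to\mathbf{Site}[(\mathcal C,J),(\mathcal D,K)]$. 2. The functor $\mathbb H$ is fully faithful. 3. There is a functor $\mathrm{Sh}:\mathbf{Site}[(\mathcal C,J),(\mathcal D,K)]\to\mathbf{Top}[\mathrm{Sh}(\mathcal D,K),\mathrm{Sh}(\mathcal C,J)]$, left adjoint to $\mathbb H$, sending $H$ to the geometric morphism induced by $H$: there are transformations $\eta_H:a_K\widehat H\Rightarrow \mathrm{Sh}(H)^*\,a_J\,y$, natural in $H$, exhibiting $\mathrm{Sh}(H)^*a_J$ as the pointwise left Kan extension of $a_K\widehat H:\mathcal C\to\mathrm{Sh}(\mathcal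 D,K)$ along $y$. Whenever the left Kan extension $\mathrm{lext}_H:\widehat{\mathcal C}\to\widehat{\mathcal D}$ of $\widehat H$ along $y$ exists (for instance if $\mathcal C$ is small), $\eta_H$ is induced by an isomorphism $a_K\,\mathrm{lext}_H\cong\mathrm{Sh}(H)^*a_J$, and $\mathrm{Sh}(H)^*\cong a_K\,\mathrm{lext}_H\,i_J$. -/

import Mathlib

open CategoryTheory Opposite Limits

universe w u₁ u₂ v₃ v₄ u₃ u₄

namespace SiteDist

section SmallGenerated

variable {C : Type u₁} [Category.{w} C]

/-- A site `(C, J)`, with `C` locally small (relative to the universe `w` of small sets), is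
*small generated* if there is a small set `P` of objects of `C` such that every object of `C` has
a `J`-covering sieve consisting of arrows which factor through an object in `P`, i.e. if it has
a small `J`-dense (full) subcategory. -/
class IsSmallGenerated (J : GrothendieckTopology C) : Prop where
  exists_dense : ∃ P : ObjectProperty C, ObjectProperty.Small.{w} P ∧ P.ι.IsCoverDense J

/-- The comparison lemma: sheaves of small sets on a small generated site admit a left exact
sheafification functor. -/
instance hasSheafify_of_isSmallGenerated (J : GrothendieckTopology C) [h : IsSmallGenerated J] :
    HasSheafify J (Type w) := by
  obtain ⟨P, hP, hd⟩ := h.exists_dense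
  have : EssentiallySmall.{w} P.FullSubcategory := by
    rw [essentiallySmall_iff]
    exact ⟨inferInstance, inferInstance⟩
  have : HasSheafify (P.ι.inducedTopology J) (Type w) :=
    hasSheafifyEssentiallySmallSite.{w} _ _
  exact Functor.IsDenseSubsite.hasSheafify_of_isEquivalence (P.ι.inducedTopology J) J P.ι

/-- Every small site is small generated. -/
instance isSmallGenerated_of_small {C : Type w} [Category.{w} C] (J : GrothendieckTopology C) :
    IsSmallGenerated J where
  exists_dense := ⟨⊤, inferInstance, ⟨fun U ↦ by
    have : Sieve.coverByImage (ObjectProperty.ι (⊤ : ObjectProperty C)) U = ⊤ := by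
      ext Y f
      exact ⟨fun _ ↦ trivial, fun _ ↦ ⟨⟨⟨Y, trivial⟩, 𝟙 _, f, Category.id_comp f⟩⟩⟩
    rw [this]
    exact J.top_mem U⟩⟩

end SmallGenerated

section Distributors

variable {C : Type u₁} [Category.{w} C] {D : Type u₂} [Category.{w} D]

/-!
A distributor `H : C ⇸ D`, i.e. a functor `Dᵒᵖ × C ⥤ Set`, is Mathlib's `Profunctor.{w} C D`,
in its curried form `C ⥤ Dᵒᵖ ⥤ Type w`; so `H(d, c)` is `(H.obj c).obj (op d)`, the presheaf
`H(-, c)` is `H.obj c`, and transformations of distributors are natural transformations.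
-/

/-- For `x ∈ H(d, c)` and a sieve `S` on `c`, the sieve `x^* H[S]` of all `v : d' ⟶ d` such that
`H(v, c)(x) = H(d', u)(x')` for some `u : c' ⟶ c` in `S` and some `x' ∈ H(d', c')`. -/
def imageSieve (H : Profunctor.{w} C D) {c : C} {d : D} (x : (H.obj c).obj (op d))
    (S : Sieve c) : Sieve d where
  arrows d' v := ∃ (c' : C) (u : c' ⟶ c) (x' : (H.obj c').obj (op d')),
    S u ∧ (H.map u).app (op d') x' = (H.obj c).map v.op x
  downward_closed := by
    rintro d' d'' v ⟨c', u, x', hu, hx⟩ g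
    refine ⟨c', u, (H.obj c').map g.op x', hu, ?_⟩
    rw [NatTrans.naturality_apply, hx]
    simp

/-- The sieve on `d` of all `v : d' ⟶ d` such that `H(d', c)` is nonempty for some `c`. -/
def supportSieve (H : Profunctor.{w} C D) (d : D) : Sieve d where
  arrows d' _ := ∃ c : C, Nonempty ((H.obj c).obj (op d'))
  downward_closed := by
    rintro d' d'' v ⟨c, ⟨x⟩⟩ g
    exact ⟨c, ⟨(H.obj c).map g.op x⟩⟩

/-- For `x ∈ H(d, c)` and `x' ∈ H(d, c')`, the sieve of all `v : d' ⟶ d` for which there are a span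
`u : c'' ⟶ c`, `u' : c'' ⟶ c'` and `x'' ∈ H(d', c'')` with `H(d', u)(x'') = H(v, c)(x)` and
`H(d', u')(x'') = H(v, c')(x')`. -/
def spanSieve (H : Profunctor.{w} C D) {c c' : C} {d : D} (x : (H.obj c).obj (op d))
    (x' : (H.obj c').obj (op d)) : Sieve d where
  arrows d' v := ∃ (c'' : C) (u : c'' ⟶ c) (u' : c'' ⟶ c') (x'' : (H.obj c'').obj (op d')),
    (H.map u).app (op d') x'' = (H.obj c).map v.op x ∧
      (H.map u').app (op d') x'' = (H.obj c').map v.op x'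
  downward_closed := by
    rintro d' d'' v ⟨c'', u, u', x'', hx, hx'⟩ g
    refine ⟨c'', u, u', (H.obj c'').map g.op x'', ?_, ?_⟩
    · rw [NatTrans.naturality_apply, hx]
      simp
    · rw [NatTrans.naturality_apply, hx']
      simp

/-- For `u, u' : c' ⟶ c` and `x ∈ H(d, c')`, the sieve of all `v : d' ⟶ d` for which there are
`t : c'' ⟶ c'` with `u ∘ t = u' ∘ t` and `x' ∈ H(d', c'')` with `H(d', t)(x') = H(v, c')(x)`. -/
def forkSieve (H : Profunctor.{w} C D) {c c' : C} (u u' : c' ⟶ c) {d : D}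
    (x : (H.obj c').obj (op d)) : Sieve d where
  arrows d' v := ∃ (c'' : C) (t : c'' ⟶ c') (x' : (H.obj c'').obj (op d')),
    t ≫ u = t ≫ u' ∧ (H.map t).app (op d') x' = (H.obj c').map v.op x
  downward_closed := by
    rintro d' d'' v ⟨c'', t, x', ht, hx⟩ g
    refine ⟨c'', t, (H.obj c'').map g.op x', ht, ?_⟩
    rw [NatTrans.naturality_apply, hx]
    simp

/-- `H` is cover-distributing from `J` to `K`: for every heteromorphism `x ∈ H(d, c)` and
every `J`-covering sieve `S` on `c`, the sieve `x^* H[S]` on `d` is `K`-covering. -/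
def IsCoverDistributing (J : GrothendieckTopology C) (K : GrothendieckTopology D)
    (H : Profunctor.{w} C D) : Prop :=
  ∀ ⦃c : C⦄ ⦃d : D⦄ (x : (H.obj c).obj (op d)) (S : Sieve c), S ∈ J c → imageSieve H x S ∈ K d

/-- `K`-flatness of a distributor. -/
structure IsCoverFlat (K : GrothendieckTopology D) (H : Profunctor.{w} C D) : Prop where
  support_mem (d : D) : supportSieve H d ∈ K d
  span_mem ⦃c c' : C⦄ ⦃d : D⦄ (x : (H.obj c).obj (op d)) (x' : (H.obj c').obj (op d)) :
    spanSieve H x x' ∈ K d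
  fork_mem ⦃c c' : C⦄ (u u' : c' ⟶ c) ⦃d : D⦄ (x : (H.obj c').obj (op d)) :
    (H.map u).app (op d) x = (H.map u').app (op d) x → forkSieve H u u' x ∈ K d

/-- The property of being a distributor of sites `(C, J) ⇸ (D, K)`. -/
def isDistributorOfSites (J : GrothendieckTopology C) (K : GrothendieckTopology D) :
    ObjectProperty (Profunctor.{w} C D) :=
  fun H ↦ IsCoverDistributing J K H ∧ IsCoverFlat K H

/-- The category of distributors of sites `(C, J) ⇸ (D, K)` and (all) transformations between
them. -/
abbrev DistributorOfSites (J : GrothendieckTopology C) (K : GrothendieckTopology D) :=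
  (isDistributorOfSites J K).FullSubcategory

end Distributors

section Geometric

/-- A geometric morphism `f : E ⟶ F`: an adjunction `f^* ⊣ f_*` with `f_* : E ⥤ F` and with
`f^* : F ⥤ E` preserving finite limits. -/
structure GeometricMorphism (E : Type u₃) [Category.{v₃} E] (F : Type u₄) [Category.{v₄} F] where
  /-- the inverse image functor `f^*` -/
  inverseImage : F ⥤ E
  /-- the direct image functor `f_*` -/
  directImage : E ⥤ F
  /-- the adjunction `f^* ⊣ f_*` -/
  adj : inverseImage ⊣ directImage
  lex : PreservesFiniteLimits inverseImage

variable {E : Type u₃} [Category.{v₃} E] {F : Type u₄} [Category.{v₄} F]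

/-- Geometric transformations `f ⟶ g` are the natural transformations `f^* ⟶ g^*`. -/
instance : Category (GeometricMorphism E F) where
  Hom f g := f.inverseImage ⟶ g.inverseImage
  id f := 𝟙 f.inverseImage
  comp φ ψ := NatTrans.vcomp φ ψ
  id_comp φ := Category.id_comp (obj := F ⥤ E) φ
  comp_id φ := Category.comp_id (obj := F ⥤ E) φ
  assoc φ ψ χ := Category.assoc (obj := F ⥤ E) φ ψ χ

/-- The functor `f ↦ f^*`. -/
def inverseImageFunctor : GeometricMorphism E F ⥤ (F ⥤ E) where
  obj f := f.inverseImage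
  map φ := φ

end Geometric

noncomputable section Comparison

variable {C : Type u₁} [Category.{w} C] {D : Type u₂} [Category.{w} D]
variable (J : GrothendieckTopology C) (K : GrothendieckTopology D)

/-- The category `Top[Sh(D, K), Sh(C, J)]` of geometric morphisms `Sh(D, K) ⟶ Sh(C, J)`. -/
abbrev Geom := GeometricMorphism (Sheaf K (Type w)) (Sheaf J (Type w))

/-- The functor `f ↦ H_f` from geometric morphisms to distributors, where
`H_f(d, c) = f^*(a_J (y c))(d)`. -/
def distributorOfGeom [HasSheafify J (Type w)] : Geom J K ⥤ Profunctor.{w} C D where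
  obj f := yoneda ⋙ presheafToSheaf J (Type w) ⋙ f.inverseImage ⋙ sheafToPresheaf K (Type w)
  map φ := Functor.whiskerLeft yoneda (Functor.whiskerLeft (presheafToSheaf J (Type w))
    (Functor.whiskerRight φ (sheafToPresheaf K (Type w))))

/-- The functor `ℍ : f ↦ H_f` from geometric morphisms to distributors of sites, given that each
`H_f` is a distributor of sites. -/
def functorH [HasSheafify J (Type w)]
    (hH : ∀ f : Geom J K, isDistributorOfSites J K ((distributorOfGeom J K).obj f)) :
    Geom J K ⥤ DistributorOfSites J K :=
  (isDistributorOfSites J K).lift (distributorOfGeom J K) hH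

/-- The functor sending a distributor of sites `H` to `a_K ∘ H : C ⥤ Sh(D, K)`,
`c ↦ a_K (H(-, c))`. -/
def sheafifiedDistributor [HasSheafify K (Type w)] :
    DistributorOfSites J K ⥤ (C ⥤ Sheaf K (Type w)) :=
  (isDistributorOfSites J K).ι ⋙ (Functor.whiskeringRight C _ _).obj (presheafToSheaf K (Type w))

/-- The functor sending a geometric morphism `f` to the composite `f^* ∘ a_J` from presheaves on
`C` to `Sh(D, K)`. -/
def presheafInverseImage [HasSheafify J (Type w)] :
    Geom J K ⥤ ((Cᵒᵖ ⥤ Type w) ⥤ Sheaf K (Type w)) :=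
  inverseImageFunctor ⋙ (Functor.whiskeringLeft _ _ _).obj (presheafToSheaf J (Type w))

/-- A functor `Sh` from distributors of sites to geometric morphisms, together with a family `η` of
transformations `η_H : a_K ∘ H ⟶ Sh(H)^* ∘ a_J ∘ y`, natural in `H`, *is the extension functor* if

* for each `H`, the transformation `η_H` exhibits `Sh(H)^* ∘ a_J` as the pointwise left Kan
  extension (computed in sheaves) of `a_K ∘ H` along the Yoneda embedding `y`;
* for each `H` and each left extension `lext_H` of `H`, i.e. each left Kan extension (computed in
  presheaves) of `H : C ⥤ (Dᵒᵖ ⥤ Type w)` along `y` (it exists as soon as `C` is small), `η_H` is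
  induced by isomorphisms `a_K ∘ lext_H ≅ Sh(H)^* ∘ a_J` and, on sheaves,
  `a_K ∘ lext_H ∘ i_J ≅ Sh(H)^*`.

Since left Kan extensions are unique up to unique isomorphism, the first condition and the
naturality of `η` determine the functor `Sh` up to isomorphism. -/
structure IsExtensionFunctor [HasSheafify J (Type w)] [HasSheafify K (Type w)]
    (Sh : DistributorOfSites J K ⥤ Geom J K)
    (η : sheafifiedDistributor J K ⟶
      Sh ⋙ presheafInverseImage J K ⋙ (Functor.whiskeringLeft _ _ _).obj yoneda) : Prop where
  pointwise (H : DistributorOfSites J K) :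
    Nonempty (Functor.LeftExtension.mk ((presheafInverseImage J K).obj (Sh.obj H))
      (η.app H)).IsPointwiseLeftKanExtension
  lext (H : DistributorOfSites J K) (L : (Cᵒᵖ ⥤ Type w) ⥤ (Dᵒᵖ ⥤ Type w))
    (α : H.obj ⟶ yoneda ⋙ L) (hL : L.IsLeftKanExtension α) :
    (∃ e : L ⋙ presheafToSheaf K (Type w) ≅
        presheafToSheaf J (Type w) ⋙ (Sh.obj H).inverseImage,
      Functor.whiskerRight α (presheafToSheaf K (Type w)) ≫ Functor.whiskerLeft yoneda e.hom =
        η.app H) ∧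
    Nonempty (sheafToPresheaf J (Type w) ⋙ L ⋙ presheafToSheaf K (Type w) ≅
      (Sh.obj H).inverseImage)

end Comparison

end SiteDist

/-! When `C` is large, the coend defining the left Kan extension of `H` into presheaves need not be
small. Cover-distribution repairs this: if a small family `p : ι → C` generates the site `C`, every
heteromorphism of `H` factors locally through some `p i`. So the sheaf extending `H` at `X` can be
built from triples `(i, a ∈ X(p i), x ∈ H(d, p i))`, identified when they are locally connected by a
span of `C`, and then sheafified. Flatness says that the elements of `H` locally form a cofiltered
category, which makes this relation transitive and the construction left exact: the comparison maps
for the terminal object and for pullbacks are locally bijective (`W_tensor_terminal_from`,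
`W_tensor_pullback_lift`).

The resulting functor is the pointwise left Kan extension of `a_K H` along `y`
(`isPointwiseLeftKanExtensionExtension`). As `Sh(D, K)` is locally small, it has the right adjoint
`Y ↦ Hom(a_K H(-), Y)`. Cover-distribution makes it invert covering sieves
(`W_tensor_map_functorInclusion`), so this right adjoint lands in `J`-sheaves and the adjunction
restricts to a geometric morphism.

Conversely, for a geometric morphism `f`, put `G = f^* a_J`. It is a left exact left adjoint
inverting covering sieves, and sections of `G X` come locally from representables over `X`
(`locally_exists_representable`). Applying this to images under `G` of finite limits of
representables, and of covering sieves, gives the axioms for `H_f`.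

Finally, `G` is the left Kan extension of `G y`, and precomposition with the localization `a_J` is
fully faithful; hence so is `ℍ`. The adjunction is the chain `Hom(Sh(H)^*, g^*) ≅ Hom(Sh(H)^* a_J,
g^* a_J) ≅ Hom(a_K H, g^* a_J y) ≅ Hom(H, H_g)`. -/

namespace SiteDist

/-! ### Local truth for a Grothendieck topology -/

section Locally

variable {D : Type u₂} [Category.{w} D]

/-- A property of arrows with codomain `d` holds locally if it holds on a covering sieve. -/
def Locally (K : GrothendieckTopology D) (d : D) (P : ∀ ⦃d' : D⦄, (d' ⟶ d) → Prop) : Prop :=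
  ∃ S ∈ K d, ∀ ⦃d' : D⦄ (v : d' ⟶ d), S v → P v

variable {K : GrothendieckTopology D} {d : D}

theorem Locally.of_mem {S : Sieve d} (hS : S ∈ K d) : Locally K d fun _ v ↦ S v :=
  ⟨S, hS, fun _ _ h ↦ h⟩

theorem Locally.mem {S : Sieve d} (h : Locally K d fun _ v ↦ S v) : S ∈ K d := by
  obtain ⟨T, hT, h⟩ := h
  exact K.superset_covering h hT

theorem Locally.of_forall {P : ∀ ⦃d' : D⦄, (d' ⟶ d) → Prop} (h : ∀ ⦃d' : D⦄ (v : d' ⟶ d), P v) :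
    Locally K d P :=
  ⟨⊤, K.top_mem d, fun _ _ _ ↦ h _⟩

theorem Locally.mono {P Q : ∀ ⦃d' : D⦄, (d' ⟶ d) → Prop} (h : Locally K d P)
    (hPQ : ∀ ⦃d' : D⦄ (v : d' ⟶ d), P v → Q v) : Locally K d Q := by
  obtain ⟨S, hS, h⟩ := h
  exact ⟨S, hS, fun _ _ hv ↦ hPQ _ (h _ hv)⟩

theorem Locally.and {P Q : ∀ ⦃d' : D⦄, (d' ⟶ d) → Prop} (hP : Locally K d P)
    (hQ : Locally K d Q) : Locally K d fun _ v ↦ P v ∧ Q v := by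
  obtain ⟨S, hS, hP⟩ := hP
  obtain ⟨T, hT, hQ⟩ := hQ
  exact ⟨S ⊓ T, K.intersection_covering hS hT, fun _ _ hv ↦ ⟨hP _ hv.1, hQ _ hv.2⟩⟩

theorem Locally.pullback {P : ∀ ⦃d' : D⦄, (d' ⟶ d) → Prop} (hP : Locally K d P) {d₁ : D}
    (g : d₁ ⟶ d) : Locally K d₁ fun _ v ↦ P (v ≫ g) := by
  obtain ⟨S, hS, hP⟩ := hP
  exact ⟨S.pullback g, K.pullback_stable g hS, fun _ _ hv ↦ hP _ hv⟩

/-- Properties which hold locally at each arrow where `P` holds, hold locally if `P` does. -/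
theorem Locally.bind {P Q : ∀ ⦃d' : D⦄, (d' ⟶ d) → Prop} (hP : Locally K d P)
    (h : ∀ ⦃d' : D⦄ (v : d' ⟶ d), P v → Locally K d' fun _ v' ↦ Q (v' ≫ v)) :
    Locally K d Q := by
  obtain ⟨S, hS, hP⟩ := hP
  choose T hT hQ using fun (d' : D) (v : d' ⟶ d) (hv : S v) ↦ h v (hP v hv)
  refine ⟨Sieve.bind S.arrows (fun d' v hv ↦ T d' v hv),
    K.bind_covering hS (fun d' v hv ↦ hT d' v hv), ?_⟩
  rintro d'' _ ⟨d', v', v, hv, hv', rfl⟩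
  exact hQ _ _ hv _ hv'

theorem Locally.eq_of_isSheaf {Y : Dᵒᵖ ⥤ Type w} (hY : Presieve.IsSheaf K Y) {y y' : Y.obj (op d)}
    (h : Locally K d fun _ v ↦ Y.map v.op y = Y.map v.op y') : y = y' := by
  obtain ⟨S, hS, h⟩ := h
  exact (hY.isSeparated _ hS).ext fun d' v hv ↦ h v hv

end Locally

/-! ### Morphisms into sheaves from local data -/

section Gluing

variable {D : Type u₂} [Category.{w} D] {K : GrothendieckTopology D}

/-- A functional relation from a presheaf to a sheaf which is stable under restriction and locally
total is induced by a morphism. -/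
theorem exists_hom_of_locally_total {P Y : Dᵒᵖ ⥤ Type w} (hY : Presieve.IsSheaf K Y)
    (R : ∀ d : D, P.obj (op d) → Y.obj (op d) → Prop)
    (hres : ∀ ⦃d d' : D⦄ (v : d' ⟶ d) x y, R d x y → R d' (P.map v.op x) (Y.map v.op y))
    (hfun : ∀ ⦃d : D⦄ x y y', R d x y → R d x y' → y = y')
    (htot : ∀ ⦃d : D⦄ (x : P.obj (op d)),
      Locally K d fun d' v ↦ ∃ y, R d' (P.map v.op x) y) :
    ∃ g : P ⟶ Y, ∀ ⦃d : D⦄ x y, R d x y → g.app (op d) x = y := by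
  -- The value at `x` is glued from local choices, compatible because `R` is functional. The
  -- property kept quantifies over every related `z` over every restriction, so it no longer depends
  -- on the choices and pins the value down.
  have key : ∀ ⦃d : D⦄ (x : P.obj (op d)), ∃ y : Y.obj (op d),
      ∀ ⦃d' : D⦄ (v : d' ⟶ d) z, R d' (P.map v.op x) z → Y.map v.op y = z := by
    intro d x
    obtain ⟨S, hS, h⟩ := htot x
    choose t ht using h
    have hc : Presieve.FamilyOfElements.Compatible (P := Y) (R := S.arrows)
        (fun _ v hv ↦ t v hv) := by
      intro d₁ d₂ d₃ g₁ g₂ f₁ f₂ h₁ h₂ e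
      apply hfun (P.map (g₁ ≫ f₁).op x)
      · simpa using hres g₁ _ _ (ht f₁ h₁)
      · rw [e]
        simpa using hres g₂ _ _ (ht f₂ h₂)
    obtain ⟨y, hy, -⟩ := hY S hS _ hc
    refine ⟨y, fun d' v z hz ↦ ?_⟩
    refine (hY.isSeparated _ (K.pullback_stable v hS)).ext fun d'' g hg ↦ ?_
    have h2 : Y.map (g ≫ v).op y = t (g ≫ v) hg := hy (g ≫ v) hg
    apply hfun (P.map (g ≫ v).op x)
    · rw [← Functor.map_comp_apply, ← op_comp, h2]
      exact ht _ _
    · simpa using hres g _ _ hz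
  have uniq : ∀ ⦃d : D⦄ (x : P.obj (op d)) (y y' : Y.obj (op d)),
      (∀ ⦃d' : D⦄ (v : d' ⟶ d) z, R d' (P.map v.op x) z → Y.map v.op y = z) →
      (∀ ⦃d' : D⦄ (v : d' ⟶ d) z, R d' (P.map v.op x) z → Y.map v.op y' = z) → y = y' := by
    intro d x y y' h h'
    obtain ⟨S, hS, ht⟩ := htot x
    refine (hY.isSeparated _ hS).ext fun d' v hv ↦ ?_
    obtain ⟨z, hz⟩ := ht v hv
    rw [h v z hz, h' v z hz]
  choose g hg using key
  refine ⟨{ app := fun d ↦ ↾(fun x ↦ g (d := d.unop) x), naturality := ?_ }, ?_⟩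
  · rintro ⟨d⟩ ⟨d'⟩ ⟨v⟩
    ext x
    change g (P.map v.op x) = Y.map v.op (g x)
    refine uniq (P.map v.op x) _ _ (hg _) fun d'' v' z hz ↦ ?_
    have := hg x (v' ≫ v) z (by simpa using hz)
    simpa using this
  · intro d x y h
    change g x = y
    simpa using hg x (𝟙 d) y (by simpa using h)

/-- Locally bijective morphisms of presheaves of types are local with respect to sheaves. -/
theorem W_of_locally_bijective {P Q : Dᵒᵖ ⥤ Type w} (f : P ⟶ Q)
    (hinj : ∀ ⦃d : D⦄ (x y : P.obj (op d)), f.app (op d) x = f.app (op d) y →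
      Locally K d fun _ v ↦ P.map v.op x = P.map v.op y)
    (hsurj : ∀ ⦃d : D⦄ (z : Q.obj (op d)), Locally K d fun d' v ↦
      ∃ x : P.obj (op d'), f.app (op d') x = Q.map v.op z) :
    K.W f := by
  intro Y hY
  rw [isSheaf_iff_isSheaf_of_type] at hY
  constructor
  · intro a b hab
    ext ⟨d⟩ z
    obtain ⟨S, hS, h⟩ := hsurj z
    refine (hY.isSeparated _ hS).ext fun d' v hv ↦ ?_
    obtain ⟨x, hx⟩ := h v hv
    have := congr($(hab).app (op d') x)
    simp only [NatTrans.comp_app, comp_apply, hx] at this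
    change Y.map v.op (a.app (op d) z) = Y.map v.op (b.app (op d) z)
    rw [← NatTrans.naturality_apply, ← NatTrans.naturality_apply]
    exact this
  · intro g
    -- The extension of `g` along `f` is the relation "`z = f x` and `y = g x`": local injectivity
    -- of `f` makes it functional, local surjectivity makes it locally total.
    obtain ⟨e, he⟩ := exists_hom_of_locally_total (P := Q) hY
      (fun d z y ↦ ∃ x : P.obj (op d), f.app (op d) x = z ∧ g.app (op d) x = y)
      (by
        rintro d d' v _ _ ⟨x, rfl, rfl⟩
        exact ⟨P.map v.op x, by rw [NatTrans.naturality_apply], by rw [NatTrans.naturality_apply]⟩)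
      (by
        rintro d _ _ _ ⟨x, rfl, rfl⟩ ⟨x', h, rfl⟩
        obtain ⟨S, hS, h⟩ := hinj _ _ h
        refine (hY.isSeparated _ hS).ext fun d' v hv ↦ ?_
        rw [← NatTrans.naturality_apply, ← NatTrans.naturality_apply, h v hv])
      (by
        intro d z
        obtain ⟨S, hS, h⟩ := hsurj z
        refine ⟨S, hS, fun d' v hv ↦ ?_⟩
        obtain ⟨x, hx⟩ := h v hv
        exact ⟨_, x, hx, rfl⟩)
    refine ⟨e, ?_⟩
    ext ⟨d⟩ x
    exact he _ _ ⟨x, rfl, rfl⟩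

end Gluing

/-! ### The tensor presheaf of a flat distributor -/

section Tensor

variable {C : Type u₁} [Category.{w} C] {D : Type u₂} [Category.{w} D]
  {K : GrothendieckTopology D} {H : Profunctor.{w} C D}

theorem map_app_map_app {c c' c'' : C} (u : c ⟶ c') (u' : c' ⟶ c'') {d : D}
    (x : (H.obj c).obj (op d)) :
    (H.map u').app (op d) ((H.map u).app (op d) x) = (H.map (u ≫ u')).app (op d) x := by
  simp

theorem map_app_obj_map {c c' : C} (u : c ⟶ c') {d d' : D} (v : d' ⟶ d)
    (x : (H.obj c).obj (op d)) :
    (H.map u).app (op d') ((H.obj c).map v.op x) = (H.obj c').map v.op ((H.map u).app (op d) x) :=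
  NatTrans.naturality_apply _ _ _

/-- The second flatness axiom gives a span over `x₁` and `x₂`; its two composites to `c` agree on
the element obtained, so the third axiom equalizes them after a further cover. -/
theorem IsCoverFlat.locally_cospan (hH : IsCoverFlat K H) {c c₁ c₂ : C} {d : D} (f₁ : c₁ ⟶ c)
    (f₂ : c₂ ⟶ c) (x₁ : (H.obj c₁).obj (op d)) (x₂ : (H.obj c₂).obj (op d))
    (h : (H.map f₁).app (op d) x₁ = (H.map f₂).app (op d) x₂) :
    Locally K d fun d' v ↦ ∃ (c₃ : C) (w₁ : c₃ ⟶ c₁) (w₂ : c₃ ⟶ c₂) (x₃ : (H.obj c₃).obj (op d')),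
      w₁ ≫ f₁ = w₂ ≫ f₂ ∧ (H.map w₁).app (op d') x₃ = (H.obj c₁).map v.op x₁ ∧
        (H.map w₂).app (op d') x₃ = (H.obj c₂).map v.op x₂ := by
  refine (Locally.of_mem (hH.span_mem x₁ x₂)).bind ?_
  rintro d₁ v ⟨c₃, w₁, w₂, x₃, h₁, h₂⟩
  refine (Locally.of_mem (hH.fork_mem (w₁ ≫ f₁) (w₂ ≫ f₂) x₃ ?_)).mono ?_
  · rw [← map_app_map_app, ← map_app_map_app, h₁, h₂, map_app_obj_map, map_app_obj_map, h]
  · rintro d₂ v' ⟨c₄, t, x₄, ht, hx⟩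
    refine ⟨c₄, t ≫ w₁, t ≫ w₂, x₄, by simpa using ht, ?_, ?_⟩
    · rw [← map_app_map_app, hx, map_app_obj_map, h₁]
      simp
    · rw [← map_app_map_app, hx, map_app_obj_map, h₂]
      simp

variable (K H) in
/-- The pairs `(a, x)` and `(b, y)` in `∐ c, X(c) × H(d, c)` are locally connected by a span. -/
def LocallyRelated (X : Cᵒᵖ ⥤ Type w) {d : D} {c c' : C} (a : X.obj (op c))
    (x : (H.obj c).obj (op d)) (b : X.obj (op c')) (y : (H.obj c').obj (op d)) : Prop :=
  Locally K d fun d' v ↦ ∃ (e : C) (u : e ⟶ c) (u' : e ⟶ c') (z : (H.obj e).obj (op d')),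
    X.map u.op a = X.map u'.op b ∧ (H.map u).app (op d') z = (H.obj c).map v.op x ∧
      (H.map u').app (op d') z = (H.obj c').map v.op y

namespace LocallyRelated

variable {X : Cᵒᵖ ⥤ Type w} {d : D} {c c' c'' : C} {a : X.obj (op c)} {x : (H.obj c).obj (op d)}
  {b : X.obj (op c')} {y : (H.obj c').obj (op d)} {e : X.obj (op c'')} {z : (H.obj c'').obj (op d)}

variable (a x) in
theorem refl : LocallyRelated K H X a x a x :=
  .of_forall fun _ v ↦ ⟨c, 𝟙 c, 𝟙 c, (H.obj c).map v.op x, by simp⟩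

theorem symm (h : LocallyRelated K H X a x b y) : LocallyRelated K H X b y a x := by
  refine Locally.mono h ?_
  rintro d' v ⟨e, u, u', z, h₁, h₂, h₃⟩
  exact ⟨e, u', u, z, h₁.symm, h₃, h₂⟩

/-- Two spans sharing the middle element `y` form a cospan over it, which `locally_cospan` completes
to a single span. -/
theorem trans (hH : IsCoverFlat K H) (h : LocallyRelated K H X a x b y)
    (h' : LocallyRelated K H X b y e z) : LocallyRelated K H X a x e z := by
  refine (Locally.and h h').bind ?_
  rintro d₁ v ⟨⟨c₁, u₁, u₁', z₁, h₁, h₂, h₃⟩, ⟨c₂, u₂, u₂', z₂, h₁', h₂', h₃'⟩⟩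
  refine (hH.locally_cospan u₁' u₂ z₁ z₂ (by rw [h₃, h₂'])).mono ?_
  rintro d₂ v' ⟨c₃, w₁, w₂, z₃, hw, hz₁, hz₂⟩
  refine ⟨c₃, w₁ ≫ u₁, w₂ ≫ u₂', z₃, ?_, ?_, ?_⟩
  · rw [op_comp, op_comp, Functor.map_comp_apply, Functor.map_comp_apply, h₁, ← h₁',
      ← Functor.map_comp_apply, ← Functor.map_comp_apply, ← op_comp, ← op_comp, hw]
  · rw [← map_app_map_app, hz₁, map_app_obj_map, h₂]
    simp
  · rw [← map_app_map_app, hz₂, map_app_obj_map, h₃']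
    simp

theorem map_right (h : LocallyRelated K H X a x b y) {d' : D} (v : d' ⟶ d) :
    LocallyRelated K H X a ((H.obj c).map v.op x) b ((H.obj c').map v.op y) := by
  refine (Locally.pullback h v).mono ?_
  rintro d' v ⟨e, u, u', z, h₁, h₂, h₃⟩
  exact ⟨e, u, u', z, h₁, by simpa using h₂, by simpa using h₃⟩

theorem map_left (h : LocallyRelated K H X a x b y) {Y : Cᵒᵖ ⥤ Type w} (f : X ⟶ Y) :
    LocallyRelated K H Y (f.app _ a) x (f.app _ b) y := by
  refine Locally.mono h ?_
  rintro d' v ⟨e, u, u', z, h₁, h₂, h₃⟩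
  exact ⟨e, u, u', z, by rw [← NatTrans.naturality_apply, h₁, NatTrans.naturality_apply], h₂, h₃⟩

variable (a) in
theorem of_map (u : c' ⟶ c) (y : (H.obj c').obj (op d)) :
    LocallyRelated K H X (X.map u.op a) y a ((H.map u).app (op d) y) :=
  .of_forall fun _ v ↦ ⟨c', 𝟙 c', u, (H.obj c').map v.op y, by simp, by simp,
    by rw [map_app_obj_map]⟩

end LocallyRelated

variable {ι : Type w} (p : ι → C) (hH : IsCoverFlat K H)

/-- The setoid of locally related triples. -/
def tensorSetoid (X : Cᵒᵖ ⥤ Type w) (d : D) :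
    Setoid (Σ i : ι, X.obj (op (p i)) × (H.obj (p i)).obj (op d)) where
  r s t := LocallyRelated K H X s.2.1 s.2.2 t.2.1 t.2.2
  iseqv := ⟨fun _ ↦ .refl _ _, fun h ↦ h.symm, fun h h' ↦ h.trans hH h'⟩

/-- The presheaf of classes of triples `(i, a ∈ X(p i), x ∈ H(d, p i))` modulo the relation of
being locally related. -/
def tensorObj (X : Cᵒᵖ ⥤ Type w) : Dᵒᵖ ⥤ Type w where
  obj d := Quotient (tensorSetoid p hH X d.unop)
  map {d d'} v := ↾(Quotient.map (fun s ↦ ⟨s.1, s.2.1, (H.obj (p s.1)).map v s.2.2⟩)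
    (fun _ _ h ↦ LocallyRelated.map_right h v.unop))
  map_id d := by
    ext ⟨_⟩
    exact congrArg (Quotient.mk _) (by simp)
  map_comp v v' := by
    ext ⟨_⟩
    exact congrArg (Quotient.mk _) (by simp)

/-- The functor sending a presheaf `X` on `C` to the presheaf of classes of triples
`(i, a ∈ X(p i), x ∈ H(d, p i))`. -/
def tensor : (Cᵒᵖ ⥤ Type w) ⥤ (Dᵒᵖ ⥤ Type w) where
  obj X := tensorObj p hH X
  map {X Y} f :=
    { app d := ↾(Quotient.map (fun s ↦ ⟨s.1, f.app _ s.2.1, s.2.2⟩)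
        (fun _ _ h ↦ LocallyRelated.map_left h f))
      naturality d d' v := by
        ext ⟨s⟩
        rfl }
  map_id X := by
    ext d ⟨s⟩
    rfl
  map_comp f g := by
    ext d ⟨s⟩
    rfl

/-- The class of a triple. -/
def tensorMk {X : Cᵒᵖ ⥤ Type w} {i : ι} {d : D} (a : X.obj (op (p i)))
    (x : (H.obj (p i)).obj (op d)) : ((tensor p hH).obj X).obj (op d) :=
  Quotient.mk (tensorSetoid p hH X d) ⟨i, a, x⟩

variable {p hH}

theorem tensorMk_surjective {X : Cᵒᵖ ⥤ Type w} {d : D} (t : ((tensor p hH).obj X).obj (op d)) :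
    ∃ (i : ι) (a : X.obj (op (p i))) (x : (H.obj (p i)).obj (op d)), tensorMk p hH a x = t := by
  obtain ⟨⟨i, a, x⟩, rfl⟩ := Quotient.exists_rep t
  exact ⟨i, a, x, rfl⟩

theorem tensorMk_eq_iff {X : Cᵒᵖ ⥤ Type w} {i j : ι} {d : D} {a : X.obj (op (p i))}
    {x : (H.obj (p i)).obj (op d)} {b : X.obj (op (p j))} {y : (H.obj (p j)).obj (op d)} :
    tensorMk p hH a x = tensorMk p hH b y ↔ LocallyRelated K H X a x b y :=
  Quotient.eq (r := tensorSetoid p hH X d)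

theorem tensor_obj_map_mk {X : Cᵒᵖ ⥤ Type w} {i : ι} {d d' : D} (v : d' ⟶ d) (a : X.obj (op (p i)))
    (x : (H.obj (p i)).obj (op d)) :
    ((tensor p hH).obj X).map v.op (tensorMk p hH a x) =
      tensorMk p hH a ((H.obj (p i)).map v.op x) :=
  rfl

theorem tensor_map_app_mk {X Y : Cᵒᵖ ⥤ Type w} (f : X ⟶ Y) {i : ι} {d : D} (a : X.obj (op (p i)))
    (x : (H.obj (p i)).obj (op d)) :
    ((tensor p hH).map f).app (op d) (tensorMk p hH a x) = tensorMk p hH (f.app _ a) x :=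
  rfl

end Tensor

/-! ### Sections of limits of presheaves -/

section Sections

variable {C : Type u₁} [Category.{w} C]

/-- Sections at `c` are morphisms from `y(c)`, so the universal property of the square applies to
them directly. -/
theorem exists_section_of_isPullback {P X Y Z : Cᵒᵖ ⥤ Type w} {fst : P ⟶ X} {snd : P ⟶ Y}
    {f : X ⟶ Z} {g : Y ⟶ Z} (sq : IsPullback fst snd f g) {c : C} (a : X.obj (op c))
    (b : Y.obj (op c)) (h : f.app _ a = g.app _ b) :
    ∃ e : P.obj (op c), fst.app _ e = a ∧ snd.app _ e = b := by
  refine ⟨yonedaEquiv (sq.lift (yonedaEquiv.symm a) (yonedaEquiv.symm b) ?_), ?_, ?_⟩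
  · rw [yonedaEquiv_symm_naturality_right, yonedaEquiv_symm_naturality_right, h]
  · rw [← yonedaEquiv_comp, sq.lift_fst, Equiv.apply_symm_apply]
  · rw [← yonedaEquiv_comp, sq.lift_snd, Equiv.apply_symm_apply]

theorem section_ext_of_isPullback {P X Y Z : Cᵒᵖ ⥤ Type w} {fst : P ⟶ X} {snd : P ⟶ Y}
    {f : X ⟶ Z} {g : Y ⟶ Z} (sq : IsPullback fst snd f g) {c : C} {e e' : P.obj (op c)}
    (h₁ : fst.app _ e = fst.app _ e') (h₂ : snd.app _ e = snd.app _ e') : e = e' := by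
  apply yonedaEquiv.symm.injective
  apply sq.hom_ext
  · rw [yonedaEquiv_symm_naturality_right, yonedaEquiv_symm_naturality_right, h₁]
  · rw [yonedaEquiv_symm_naturality_right, yonedaEquiv_symm_naturality_right, h₂]

theorem subsingleton_section_of_isTerminal {X : Cᵒᵖ ⥤ Type w} (hX : IsTerminal X) (c : C) :
    Subsingleton (X.obj (op c)) :=
  ⟨fun _ _ ↦ yonedaEquiv.symm.injective (hX.hom_ext _ _)⟩

theorem nonempty_section_of_isTerminal {X : Cᵒᵖ ⥤ Type w} (hX : IsTerminal X) (c : C) :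
    Nonempty (X.obj (op c)) :=
  ⟨yonedaEquiv (hX.from _)⟩

end Sections

/-! ### Left exactness of the sheafified tensor -/

section LeftExact

variable {C : Type u₁} [Category.{w} C] {D : Type u₂} [Category.{w} D]
  {K : GrothendieckTopology D} {H : Profunctor.{w} C D} {ι : Type w} {p : ι → C}

variable (K H p) in
/-- Heteromorphisms of `H` locally factor through the objects in the family `p`. -/
def LocallyFactors : Prop :=
  ∀ ⦃c : C⦄ ⦃d : D⦄ (x : (H.obj c).obj (op d)), Locally K d fun d' v ↦
    ∃ (i : ι) (u : p i ⟶ c) (x' : (H.obj (p i)).obj (op d')),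
      (H.map u).app (op d') x' = (H.obj c).map v.op x

variable (hH : IsCoverFlat K H) (hp : LocallyFactors K H p)

include hp in
theorem W_tensor_terminal_from :
    K.W (terminal.from ((tensor p hH).obj (⊤_ (Cᵒᵖ ⥤ Type w)))) := by
  apply W_of_locally_bijective
  · intro d x y _
    obtain ⟨i, a, x, rfl⟩ := tensorMk_surjective x
    -- Equality of classes is itself a local condition, so the two classes turn out equal without
    -- any restriction.
    obtain ⟨j, b, y, rfl⟩ := tensorMk_surjective y
    have : Subsingleton ((⊤_ (Cᵒᵖ ⥤ Type w)).obj (op (p i))) :=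
      subsingleton_section_of_isTerminal terminalIsTerminal _
    refine .of_forall fun d₁ v₁ ↦ congrArg _ ?_
    rw [tensorMk_eq_iff]
    refine Locally.mono (Locally.of_mem (hH.span_mem x y)) ?_
    rintro d' v ⟨e, u, u', z, h₁, h₂⟩
    exact ⟨e, u, u', z, (subsingleton_section_of_isTerminal terminalIsTerminal _).elim _ _, h₁, h₂⟩
  · intro d z
    refine (Locally.of_mem (hH.support_mem d)).bind ?_
    rintro d₁ v₁ ⟨c, ⟨x⟩⟩
    refine (hp x).mono ?_
    rintro d₂ v₂ ⟨i, u, x', -⟩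
    obtain ⟨a⟩ := nonempty_section_of_isTerminal (terminalIsTerminal (C := Cᵒᵖ ⥤ Type w)) (p i)
    exact ⟨tensorMk p hH a x', (subsingleton_section_of_isTerminal terminalIsTerminal _).elim _ _⟩

include hp in
theorem W_tensor_pullback_lift {P X Y Z : Cᵒᵖ ⥤ Type w} {fst : P ⟶ X} {snd : P ⟶ Y}
    {f : X ⟶ Z} {g : Y ⟶ Z} (sq : IsPullback fst snd f g) {Q : Dᵒᵖ ⥤ Type w}
    {fst' : Q ⟶ (tensor p hH).obj X} {snd' : Q ⟶ (tensor p hH).obj Y}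
    (sq' : IsPullback fst' snd' ((tensor p hH).map f) ((tensor p hH).map g))
    (m : (tensor p hH).obj P ⟶ Q) (h₁ : m ≫ fst' = (tensor p hH).map fst)
    (h₂ : m ≫ snd' = (tensor p hH).map snd) : K.W m := by
  have hfst (d : D) (x : ((tensor p hH).obj P).obj (op d)) :
      fst'.app _ (m.app _ x) = ((tensor p hH).map fst).app _ x := by
    rw [← h₁]; rfl
  have hsnd (d : D) (x : ((tensor p hH).obj P).obj (op d)) :
      snd'.app _ (m.app _ x) = ((tensor p hH).map snd).app _ x := by
    rw [← h₂]; rfl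
  apply W_of_locally_bijective
  · intro d x y hxy
    refine .of_forall fun d₁ v₁ ↦ congrArg _ ?_
    have e₁ := (hfst _ x).symm.trans ((congrArg _ hxy).trans (hfst _ y))
    have e₂ := (hsnd _ x).symm.trans ((congrArg _ hxy).trans (hsnd _ y))
    obtain ⟨i, a, x, rfl⟩ := tensorMk_surjective x
    obtain ⟨j, b, y, rfl⟩ := tensorMk_surjective y
    rw [tensor_map_app_mk, tensor_map_app_mk, tensorMk_eq_iff] at e₁ e₂
    rw [tensorMk_eq_iff]
    refine (Locally.and e₁ e₂).bind ?_
    rintro d₁ v₁ ⟨⟨c₁, u₁, u₁', z₁, ha₁, hx₁, hy₁⟩, ⟨c₂, u₂, u₂', z₂, ha₂, hx₂, hy₂⟩⟩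
    -- Equality of the two projections provides two unrelated spans from `x` to `y`. The cospan
    -- property aligns their legs over `x`, and the third flatness axiom then aligns their legs over
    -- `y`; the common span serves both projections, which are jointly injective.
    refine (hH.locally_cospan u₁ u₂ z₁ z₂ (by rw [hx₁, hx₂])).bind ?_
    rintro d₂ v₂ ⟨c₃, w₁, w₂, z₃, hw, hz₁, hz₂⟩
    refine (Locally.of_mem (hH.fork_mem (w₁ ≫ u₁') (w₂ ≫ u₂') z₃ ?_)).mono ?_
    · rw [← map_app_map_app, ← map_app_map_app, hz₁, hz₂, map_app_obj_map, map_app_obj_map,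
        hy₁, hy₂]
    · rintro d₃ v₃ ⟨c₄, t, z₄, ht, hz₄⟩
      refine ⟨c₄, t ≫ w₁ ≫ u₁, t ≫ w₁ ≫ u₁', z₄, ?_, ?_, ?_⟩
      · apply section_ext_of_isPullback sq
        · rw [NatTrans.naturality_apply, NatTrans.naturality_apply]
          simp only [op_comp, Functor.map_comp_apply, ha₁]
        · rw [ht, hw, NatTrans.naturality_apply, NatTrans.naturality_apply]
          simp only [op_comp, Functor.map_comp_apply, ha₂]
      · rw [← map_app_map_app, hz₄, map_app_obj_map, ← map_app_map_app, hz₁, map_app_obj_map, hx₁]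
        simp
      · rw [← map_app_map_app, hz₄, map_app_obj_map, ← map_app_map_app, hz₁, map_app_obj_map, hy₁]
        simp
  · intro d z
    have hz : ((tensor p hH).map f).app _ (fst'.app _ z) =
        ((tensor p hH).map g).app _ (snd'.app _ z) := by
      have := congr($(sq'.w).app (op d) z)
      exact this
    obtain ⟨i, a, x, hx⟩ := tensorMk_surjective (fst'.app _ z)
    obtain ⟨j, b, y, hy⟩ := tensorMk_surjective (snd'.app _ z)
    rw [← hx, ← hy, tensor_map_app_mk, tensor_map_app_mk, tensorMk_eq_iff] at hz
    refine Locally.bind hz ?_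
    rintro d₁ v₁ ⟨c₁, u₁, u₁', z₁, ha₁, hx₁, hy₁⟩
    rw [← NatTrans.naturality_apply, ← NatTrans.naturality_apply] at ha₁
    obtain ⟨e, he₁, he₂⟩ := exists_section_of_isPullback sq _ _ ha₁
    -- The section `e` lives over the apex `c₁`, which need not belong to the family `p`; factoring
    -- `z₁` locally through some `p k` turns `e` into a legitimate triple.
    refine (hp z₁).mono ?_
    rintro d₂ v₂ ⟨k, u, z₂, hz₂⟩
    refine ⟨tensorMk p hH (P.map u.op e) z₂, section_ext_of_isPullback sq' ?_ ?_⟩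
    · rw [hfst, NatTrans.naturality_apply, ← hx, tensor_map_app_mk, tensor_obj_map_mk,
        tensorMk_eq_iff]
      refine .of_forall fun d₃ v₃ ↦ ⟨p k, 𝟙 _, u ≫ u₁, (H.obj (p k)).map v₃.op z₂, ?_, ?_, ?_⟩
      · rw [NatTrans.naturality_apply, he₁]
        simp
      · simp
      · rw [map_app_obj_map, ← map_app_map_app, hz₂, map_app_obj_map, hx₁]
        simp
    · rw [hsnd, NatTrans.naturality_apply, ← hy, tensor_map_app_mk, tensor_obj_map_mk,
        tensorMk_eq_iff]
      refine .of_forall fun d₃ v₃ ↦ ⟨p k, 𝟙 _, u ≫ u₁', (H.obj (p k)).map v₃.op z₂, ?_, ?_, ?_⟩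
      · rw [NatTrans.naturality_apply, he₂]
        simp
      · simp
      · rw [map_app_obj_map, ← map_app_map_app, hz₂, map_app_obj_map, hy₁]
        simp

include hp in
theorem preservesFiniteLimits_tensor_sheafify [HasSheafify K (Type w)] :
    PreservesFiniteLimits (tensor p hH ⋙ presheafToSheaf K (Type w)) := by
  have : PreservesLimitsOfShape (Discrete.{0} PEmpty)
      (tensor p hH ⋙ presheafToSheaf K (Type w)) := by
    have : PreservesLimit (Functor.empty.{0} _) (tensor p hH ⋙ presheafToSheaf K (Type w)) := by
      have h := (K.W_iff _).1 (W_tensor_terminal_from hH hp)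
      exact preservesTerminal_of_iso _ (asIso ((presheafToSheaf K (Type w)).map
        (terminal.from ((tensor p hH).obj (⊤_ (Cᵒᵖ ⥤ Type w))))) ≪≫
          PreservesTerminal.iso (presheafToSheaf K (Type w)))
    exact preservesLimitsOfShape_pempty_of_preservesTerminal _
  have : PreservesLimitsOfShape WalkingCospan (tensor p hH ⋙ presheafToSheaf K (Type w)) := by
    refine ⟨fun {F} ↦ ?_⟩
    refine @preservesLimit_of_iso_diagram _ _ _ _ _ _ _ _ _ (diagramIsoCospan F).symm ?_
    generalize F.map WalkingCospan.Hom.inl = f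
    generalize F.map WalkingCospan.Hom.inr = g
    have sq := IsPullback.of_hasPullback f g
    rw [sq.preservesLimit_cospan_iff]
    have sq' := IsPullback.of_hasPullback ((tensor p hH).map f) ((tensor p hH).map g)
    let m := sq'.lift ((tensor p hH).map (pullback.fst f g)) ((tensor p hH).map (pullback.snd f g))
      (by rw [← Functor.map_comp, ← Functor.map_comp, sq.w])
    have hm : IsIso ((presheafToSheaf K (Type w)).map m) :=
      (K.W_iff _).1 (W_tensor_pullback_lift hH hp sq sq' m (sq'.lift_fst _ _ _) (sq'.lift_snd _ _ _))
    refine (sq'.map (presheafToSheaf K (Type w))).of_iso'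
      (asIso ((presheafToSheaf K (Type w)).map m)) (Iso.refl _) (Iso.refl _) (Iso.refl _) ?_ ?_ ?_ ?_
    · simp [← Functor.map_comp, m]
    · simp [← Functor.map_comp, m]
    · simp
    · simp
  exact preservesFiniteLimits_of_preservesTerminal_and_pullbacks _

end LeftExact

/-! ### The pointwise Kan extension into sheaves -/

section Extension

variable {C : Type u₁} [Category.{w} C] {D : Type u₂} [Category.{w} D]
  {K : GrothendieckTopology D} {H : Profunctor.{w} C D} {ι : Type w} {p : ι → C}
  (hH : IsCoverFlat K H) (hp : LocallyFactors K H p)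

include hp in
theorem hom_ext_of_locallyFactors {c : C} {Y : Dᵒᵖ ⥤ Type w} (hY : Presieve.IsSheaf K Y)
    {f g : H.obj c ⟶ Y} (h : ∀ ⦃d : D⦄ (i : ι) (u : p i ⟶ c) (x : (H.obj (p i)).obj (op d)),
      f.app _ ((H.map u).app _ x) = g.app _ ((H.map u).app _ x)) : f = g := by
  ext ⟨d⟩ x
  change f.app _ x = g.app _ x
  refine ((hp x).mono ?_).eq_of_isSheaf hY
  rintro d' v ⟨i, u, x', hx'⟩
  rw [← NatTrans.naturality_apply, ← NatTrans.naturality_apply, ← hx', h]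

/-- Compatibility of `σ` gives equality on each connecting span, and a sheaf is separated. This
makes `tensorDesc` well defined. -/
theorem LocallyRelated.app_eq {X : Cᵒᵖ ⥤ Type w} {Y : Dᵒᵖ ⥤ Type w} (hY : Presieve.IsSheaf K Y)
    (σ : ∀ ⦃c : C⦄, X.obj (op c) → (H.obj c ⟶ Y))
    (hσ : ∀ ⦃c c' : C⦄ (u : c' ⟶ c) (a : X.obj (op c)), σ (X.map u.op a) = H.map u ≫ σ a)
    {d : D} {c c' : C} {a : X.obj (op c)} {x : (H.obj c).obj (op d)}
    {b : X.obj (op c')} {y : (H.obj c').obj (op d)} (h : LocallyRelated K H X a x b y) :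
    (σ a).app _ x = (σ b).app _ y := by
  refine (Locally.mono h ?_).eq_of_isSheaf hY
  rintro d' v ⟨e, u, u', z, h₁, h₂, h₃⟩
  rw [← NatTrans.naturality_apply, ← NatTrans.naturality_apply, ← h₂, ← h₃]
  have := congr(($(hσ u a)).app _ z)
  rw [h₁, hσ u' b] at this
  exact this.symm

/-- A compatible family of morphisms from `H(-, c)` to a sheaf, indexed by the sections of `X`,
induces a morphism on the tensor presheaf. -/
def tensorDesc {X : Cᵒᵖ ⥤ Type w} {Y : Dᵒᵖ ⥤ Type w} (hY : Presieve.IsSheaf K Y)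
    (σ : ∀ ⦃c : C⦄, X.obj (op c) → (H.obj c ⟶ Y))
    (hσ : ∀ ⦃c c' : C⦄ (u : c' ⟶ c) (a : X.obj (op c)), σ (X.map u.op a) = H.map u ≫ σ a) :
    (tensor p hH).obj X ⟶ Y where
  app d := ↾(Quotient.lift (fun s ↦ (σ s.2.1).app d s.2.2)
    (fun _ _ h ↦ LocallyRelated.app_eq hY σ hσ h))
  naturality d d' v := by
    ext ⟨s⟩
    exact NatTrans.naturality_apply (σ s.2.1) v s.2.2

theorem tensor_hom_ext {X : Cᵒᵖ ⥤ Type w} {Y : Dᵒᵖ ⥤ Type w} {f g : (tensor p hH).obj X ⟶ Y}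
    (h : ∀ ⦃d : D⦄ (i : ι) (a : X.obj (op (p i))) (x : (H.obj (p i)).obj (op d)),
      f.app _ (tensorMk p hH a x) = g.app _ (tensorMk p hH a x)) : f = g := by
  ext ⟨d⟩ t
  obtain ⟨i, a, x, rfl⟩ := tensorMk_surjective t
  exact h i a x

theorem isSheaf_sheaf (Y : Sheaf K (Type w)) : Presieve.IsSheaf K Y.obj :=
  (isSheaf_iff_isSheaf_of_type _ _).1 Y.property

theorem tensorMk_map_eq {X : Cᵒᵖ ⥤ Type w} {i j : ι} {d : D} {c : C} (a : X.obj (op c))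
    {u : p i ⟶ c} {u' : p j ⟶ c} {x : (H.obj (p i)).obj (op d)} {x' : (H.obj (p j)).obj (op d)}
    (h : (H.map u).app _ x = (H.map u').app _ x') :
    tensorMk p hH (X.map u.op a) x = tensorMk p hH (X.map u'.op a) x' := by
  rw [tensorMk_eq_iff]
  have h₂ := LocallyRelated.of_map (K := K) a u' x'
  rw [← h] at h₂
  exact (LocallyRelated.of_map a u x).trans hH h₂.symm

variable [HasSheafify K (Type w)]

variable (p) in
/-- The extension to presheaves of the sheafification of a flat distributor. -/
noncomputable def extension : (Cᵒᵖ ⥤ Type w) ⥤ Sheaf K (Type w) :=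
  tensor p hH ⋙ presheafToSheaf K (Type w)

include hp in
-- An element of `H(d, c)` is only locally of the form `H(u)(x')` with `u : p i ⟶ c`. The classes of
-- the pairs `(u, x')` must therefore be glued, which takes place in the sheafified tensor.
theorem exists_extensionUnit (c : C) :
    ∃ γ : H.obj c ⟶ ((extension p hH).obj (yoneda.obj c)).obj,
      ∀ ⦃d : D⦄ (i : ι) (u : p i ⟶ c) (x : (H.obj (p i)).obj (op d)),
        γ.app _ ((H.map u).app _ x) = (toSheafify K ((tensor p hH).obj (yoneda.obj c))).app _
          (tensorMk p hH (X := yoneda.obj c) u x) := by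
  obtain ⟨γ, hγ⟩ := exists_hom_of_locally_total (P := H.obj c)
    (isSheaf_sheaf ((extension p hH).obj (yoneda.obj c)))
    (fun d x y ↦ ∃ (i : ι) (u : p i ⟶ c) (x' : (H.obj (p i)).obj (op d)),
      (H.map u).app _ x' = x ∧ (toSheafify K ((tensor p hH).obj (yoneda.obj c))).app _
          (tensorMk p hH (X := yoneda.obj c) u x') = y)
    (by
      rintro d d' v _ _ ⟨i, u, x', rfl, rfl⟩
      refine ⟨i, u, (H.obj _).map v.op x', map_app_obj_map _ _ _, ?_⟩
      rw [← tensor_obj_map_mk]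
      exact NatTrans.naturality_apply _ _ _)
    (by
      rintro d _ _ _ ⟨i, u, x, rfl, rfl⟩ ⟨j, u', x', h, rfl⟩
      have := tensorMk_map_eq hH (X := yoneda.obj c) (𝟙 c) h
      simp only [yoneda_obj_map, Quiver.Hom.unop_op] at this
      simpa using congrArg _ this.symm)
    (by
      intro d x
      refine (hp x).mono ?_
      rintro d' v ⟨i, u, x', h⟩
      exact ⟨_, i, u, x', h, rfl⟩)
  exact ⟨γ, fun d i u x ↦ hγ _ _ ⟨i, u, x, rfl, rfl⟩⟩

/-- The canonical morphism from `H(-, c)` to the extension of `H` at `y(c)`. -/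
noncomputable def extensionUnitApp (c : C) :
    H.obj c ⟶ ((extension p hH).obj (yoneda.obj c)).obj :=
  (exists_extensionUnit hH hp c).choose

theorem extensionUnitApp_spec {c : C} {d : D} (i : ι) (u : p i ⟶ c)
    (x : (H.obj (p i)).obj (op d)) :
    (extensionUnitApp hH hp c).app _ ((H.map u).app _ x) =
      (toSheafify K ((tensor p hH).obj (yoneda.obj c))).app _
        (tensorMk p hH (X := yoneda.obj c) u x) :=
  (exists_extensionUnit hH hp c).choose_spec i u x

theorem extensionUnitApp_comp_map_spec {X : Cᵒᵖ ⥤ Type w} {c : C} {d : D} (f : yoneda.obj c ⟶ X)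
    (i : ι) (u : p i ⟶ c) (x : (H.obj (p i)).obj (op d)) :
    (extensionUnitApp hH hp c ≫ ((extension p hH).map f).hom).app _ ((H.map u).app _ x) =
      (toSheafify K ((tensor p hH).obj X)).app _ (tensorMk p hH (f.app _ u) x) := by
  have h₁ := extensionUnitApp_spec hH hp i u x
  have h₂ := congr($(toSheafify_naturality K ((tensor p hH).map f)).app (op d)
    (tensorMk p hH (X := yoneda.obj c) u x))
  simp only [NatTrans.comp_app, comp_apply] at h₂ ⊢
  rw [h₁]
  exact h₂.symm

theorem extensionUnitApp_comp_map_symm_spec {X : Cᵒᵖ ⥤ Type w} {c : C} {d : D} (a : X.obj (op c))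
    (i : ι) (u : p i ⟶ c) (x : (H.obj (p i)).obj (op d)) :
    (extensionUnitApp hH hp c ≫ ((extension p hH).map (yonedaEquiv.symm a)).hom).app _
      ((H.map u).app _ x) =
      (toSheafify K ((tensor p hH).obj X)).app _ (tensorMk p hH (X.map u.op a) x) :=
  extensionUnitApp_comp_map_spec hH hp _ i u x

/-- The canonical transformation from the sheafification of a flat distributor to its extension. -/
noncomputable def extensionUnit :
    H ⋙ presheafToSheaf K (Type w) ⟶ yoneda ⋙ extension p hH where
  app c := ((sheafificationAdjunction K (Type w)).homEquiv _ _).symm (extensionUnitApp hH hp c)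
  naturality c c' f := by
    dsimp only [Functor.comp_map]
    rw [← Adjunction.homEquiv_naturality_left_symm, ← Adjunction.homEquiv_naturality_right_symm]
    congr 1
    refine hom_ext_of_locallyFactors hp (isSheaf_sheaf _) fun d i u x ↦ ?_
    refine Eq.trans ?_ (extensionUnitApp_comp_map_spec hH hp (yoneda.map f) i u x).symm
    have := extensionUnitApp_spec hH hp i (u ≫ f) x
    simp only [NatTrans.comp_app, comp_apply, map_app_map_app]
    exact this

theorem homEquiv_extensionUnit_comp {c : C} {X : Cᵒᵖ ⥤ Type w} (f : yoneda.obj c ⟶ X)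
    {Y : Sheaf K (Type w)} (m : (extension p hH).obj X ⟶ Y) :
    (sheafificationAdjunction K (Type w)).homEquiv _ _
      ((extensionUnit hH hp).app c ≫ (extension p hH).map f ≫ m) =
      extensionUnitApp hH hp c ≫ ((extension p hH).map f).hom ≫ m.hom := by
  rw [extensionUnit, Adjunction.homEquiv_naturality_right, Equiv.apply_symm_apply]
  rfl

/-- The extension of `H` is the pointwise left Kan extension of the sheafification of `H`. -/
noncomputable def isPointwiseLeftKanExtensionExtension :
    (Functor.LeftExtension.mk (extension p hH)
      (extensionUnit hH hp)).IsPointwiseLeftKanExtension := fun X ↦ by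
  -- By Yoneda, a cocone over the arrows `y(c) ⟶ X` is a compatible family indexed by all sections
  -- of `X`; its transposes under sheafification are the input of `tensorDesc`.
  let ℓ (s : Cocone (CostructuredArrow.proj yoneda X ⋙ H ⋙ presheafToSheaf K (Type w))) ⦃c : C⦄
      (a : X.obj (op c)) : (presheafToSheaf K (Type w)).obj (H.obj c) ⟶ s.pt :=
    s.ι.app (CostructuredArrow.mk (yonedaEquiv.symm a))
  have hℓ s ⦃c c' : C⦄ (u : c' ⟶ c) (a : X.obj (op c)) :
      ℓ s (X.map u.op a) = (presheafToSheaf K (Type w)).map (H.map u) ≫ ℓ s a :=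
    (s.w (CostructuredArrow.homMk u (yonedaEquiv_symm_naturality_left u X a) :
      CostructuredArrow.mk (yonedaEquiv.symm (X.map u.op a)) ⟶
        CostructuredArrow.mk (yonedaEquiv.symm a))).symm
  let σ (s : Cocone (CostructuredArrow.proj yoneda X ⋙ H ⋙ presheafToSheaf K (Type w))) ⦃c : C⦄
      (a : X.obj (op c)) : H.obj c ⟶ s.pt.obj :=
    (sheafificationAdjunction K (Type w)).homEquiv _ _ (ℓ s a)
  have hσ s ⦃c c' : C⦄ (u : c' ⟶ c) (a : X.obj (op c)) :
      σ s (X.map u.op a) = H.map u ≫ σ s a := by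
    dsimp only [σ]
    rw [hℓ]
    exact Adjunction.homEquiv_naturality_left _ _ _
  let δ (s : Cocone (CostructuredArrow.proj yoneda X ⋙ H ⋙ presheafToSheaf K (Type w))) :
      (extension p hH).obj X ⟶ s.pt :=
    ((sheafificationAdjunction K (Type w)).homEquiv _ _).symm
      (tensorDesc hH (isSheaf_sheaf s.pt) (σ s) (hσ s))
  have hδ s : toSheafify K ((tensor p hH).obj X) ≫ (δ s).hom =
      tensorDesc hH (isSheaf_sheaf s.pt) (σ s) (hσ s) :=
    ((sheafificationAdjunction K (Type w)).homEquiv_unit ..).symm.trans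
      (Equiv.apply_symm_apply _ _)
  have hδ' s {d : D} (i : ι) (a : X.obj (op (p i))) (x : (H.obj (p i)).obj (op d)) :
      (δ s).hom.app _ ((toSheafify K ((tensor p hH).obj X)).app _ (tensorMk p hH a x)) =
        (σ s a).app _ x := by
    have := congr($(hδ s).app _ (tensorMk p hH a x))
    exact this
  refine
    { desc := δ
      fac s j := ?_
      uniq s m hm := ?_ }
  · obtain ⟨c, ⟨⟨⟩⟩, f⟩ := j
    obtain ⟨a : X.obj (op c), rfl⟩ := yonedaEquiv.symm.surjective f
    change ((extensionUnit hH hp).app c ≫ (extension p hH).map (yonedaEquiv.symm a)) ≫ δ s = ℓ s a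
    rw [Category.assoc]
    apply ((sheafificationAdjunction K (Type w)).homEquiv _ _).injective
    refine (homEquiv_extensionUnit_comp hH hp _ _).trans ?_
    refine hom_ext_of_locallyFactors hp (isSheaf_sheaf _) fun d i u x ↦ ?_
    have h₁ := congrArg ((δ s).hom.app (op d))
      (extensionUnitApp_comp_map_symm_spec hH hp a i u x)
    rw [hδ', hσ] at h₁
    exact h₁
  · apply ((sheafificationAdjunction K (Type w)).homEquiv _ _).injective
    refine (Adjunction.homEquiv_unit ..).trans (Eq.trans ?_ (Equiv.apply_symm_apply _ _).symm)
    refine tensor_hom_ext hH fun d i a x ↦ ?_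
    -- Taking `c = p i` and `u = 𝟙` in the specification of the unit reaches every class `tensorMk p
    -- hH a x`, which determines `m`.
    have h₁ : (extensionUnit hH hp).app (p i) ≫ (extension p hH).map (yonedaEquiv.symm a) ≫ m =
      ℓ s a := (Category.assoc _ _ _).symm.trans (hm (CostructuredArrow.mk (yonedaEquiv.symm a)))
    have h₂ := (homEquiv_extensionUnit_comp hH hp _ _).symm.trans
      (congrArg ((sheafificationAdjunction K (Type w)).homEquiv _ _) h₁)
    have h₃ := congr($(h₂).app (op d) ((H.map (𝟙 (p i))).app (op d) x))
    have h₄ := congrArg (m.hom.app (op d))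
      (extensionUnitApp_comp_map_symm_spec hH hp a i (𝟙 _) x)
    have e₁ : X.map (𝟙 (p i)).op a = a := by simp
    have e₂ : (H.map (𝟙 (p i))).app (op d) x = x := by simp
    rw [e₁] at h₄
    refine h₄.symm.trans (h₃.trans ?_)
    rw [e₂]
    rfl

end Extension

/-! ### Small generation and local smallness -/

section SmallGenerators

variable {D : Type u₂} [Category.{w} D]

theorem IsSmallGenerated.exists_family (K : GrothendieckTopology D) [h : IsSmallGenerated K] :
    ∃ (κ : Type w) (q : κ → D), ∀ d : D, Locally K d fun d' v ↦
      ∃ (k : κ) (a : d' ⟶ q k) (b : q k ⟶ d), a ≫ b = v := by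
  obtain ⟨P, hP, hd⟩ := h.exists_dense
  have : Small.{w} (Subtype P) := hP
  refine ⟨Shrink.{w} (Subtype P), fun k ↦ ((equivShrink _).symm k).1, fun d ↦ ?_⟩
  refine (Locally.of_mem (hd.is_cover d)).mono ?_
  rintro d' v ⟨⟨⟨o, ho⟩, a, b, fac⟩⟩
  have e : ((equivShrink (Subtype P)).symm (equivShrink _ ⟨o, ho⟩)).1 = o := by simp
  exact ⟨equivShrink _ ⟨o, ho⟩, a ≫ eqToHom e.symm, eqToHom e ≫ b, by simpa using fac⟩

instance locallySmall_sheaf (K : GrothendieckTopology D) [IsSmallGenerated K] :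
    LocallySmall.{w} (Sheaf K (Type w)) where
  hom_small X Y := by
    obtain ⟨κ, q, hq⟩ := IsSmallGenerated.exists_family K
    -- A morphism of sheaves is determined by its components at the small generating family.
    refine small_of_injective (β := ∀ k : κ, X.obj.obj (op (q k)) → Y.obj.obj (op (q k)))
      (f := fun f k x ↦ f.hom.app _ x) fun f g hfg ↦ ?_
    ext ⟨d⟩ x
    change f.hom.app _ x = g.hom.app _ x
    refine ((hq d).mono ?_).eq_of_isSheaf (isSheaf_sheaf Y)
    rintro d' _ ⟨k, a, b, rfl⟩
    rw [op_comp, Functor.map_comp_apply, Functor.map_comp_apply, ← NatTrans.naturality_apply,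
      ← NatTrans.naturality_apply, ← NatTrans.naturality_apply, ← NatTrans.naturality_apply]
    exact (NatTrans.naturality_apply _ _ _).trans ((congrArg _ (congr_fun (congr_fun hfg k) _)).trans
      (NatTrans.naturality_apply _ _ _).symm)

end SmallGenerators

/-! ### Right adjoints of Kan extensions along Yoneda -/

section SheafCondition

variable {C : Type u₁} [Category.{w} C] {E : Type u₃} [Category.{v₃} E]
  {L : (Cᵒᵖ ⥤ Type w) ⥤ E}

/-- The right adjoint of a functor which inverts the inclusion of a sieve satisfies the sheaf
condition for this sieve. -/
theorem isSheafFor_of_isIso_map_functorInclusion {R : E ⥤ (Cᵒᵖ ⥤ Type w)} (adj : L ⊣ R) {c : C}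
    (S : Sieve c) [IsIso (L.map S.functorInclusion)] (Y : E) :
    Presieve.IsSheafFor (R.obj Y) S.arrows := by
  rw [Presieve.isSheafFor_iff_yonedaSheafCondition]
  intro f
  refine ⟨adj.homEquiv _ _ (inv (L.map S.functorInclusion) ≫ (adj.homEquiv _ _).symm f), ?_, ?_⟩
  · dsimp only
    rw [← Adjunction.homEquiv_naturality_left]
    simp
  · rintro g rfl
    rw [Adjunction.homEquiv_naturality_left_symm]
    simp

end SheafCondition

section RightAdjoint

variable {C : Type u₁} [Category.{w} C] {E : Type u₃} [Category.{v₃} E] [LocallySmall.{w} E]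
  {A : C ⥤ E} {L : (Cᵒᵖ ⥤ Type w) ⥤ E} {α : A ⟶ yoneda ⋙ L}

/-- The restriction along `A` of the Yoneda embedding of a locally small category. -/
noncomputable abbrev restrictedShrinkYoneda (A : C ⥤ E) : E ⥤ (Cᵒᵖ ⥤ Type w) :=
  shrinkYoneda.{w} ⋙ (Functor.whiskeringLeft _ _ _).obj A.op

/-- Sections of the restricted Yoneda presheaf are morphisms. -/
noncomputable abbrev restrictedShrinkYonedaEquiv {Y : E} {c : C} :
    ((restrictedShrinkYoneda.{w} A).obj Y).obj (op c) ≃ (A.obj c ⟶ Y) :=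
  shrinkYonedaObjObjEquiv

theorem restrictedShrinkYonedaEquiv_map {Y : E} {c c' : C} (u : c' ⟶ c)
    (a : ((restrictedShrinkYoneda.{w} A).obj Y).obj (op c)) :
    restrictedShrinkYonedaEquiv (((restrictedShrinkYoneda.{w} A).obj Y).map u.op a) =
      A.map u ≫ restrictedShrinkYonedaEquiv a :=
  shrinkYonedaObjObjEquiv_obj_map _ _

theorem restrictedShrinkYonedaEquiv_app {Y Y' : E} {c : C} (f : Y ⟶ Y')
    (a : ((restrictedShrinkYoneda.{w} A).obj Y).obj (op c)) :
    restrictedShrinkYonedaEquiv (((restrictedShrinkYoneda.{w} A).map f).app _ a) =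
      restrictedShrinkYonedaEquiv a ≫ f :=
  shrinkYonedaObjObjEquiv_map_app _ _

theorem restrictedShrinkYonedaEquiv_app_map {X : Cᵒᵖ ⥤ Type w} {Y : E}
    (φ : X ⟶ (restrictedShrinkYoneda.{w} A).obj Y) {c c' : C} (u : c' ⟶ c) (a : X.obj (op c)) :
    restrictedShrinkYonedaEquiv (φ.app _ (X.map u.op a)) =
      A.map u ≫ restrictedShrinkYonedaEquiv (φ.app _ a) := by
  rw [NatTrans.naturality_apply]
  exact restrictedShrinkYonedaEquiv_map _ _

variable (hL : (Functor.LeftExtension.mk L α).IsPointwiseLeftKanExtension)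

/-- The cocone corresponding to a morphism to a restricted Yoneda presheaf. -/
noncomputable def coconeOfHomRestrictedShrinkYoneda {X : Cᵒᵖ ⥤ Type w} {Y : E}
    (φ : X ⟶ (restrictedShrinkYoneda.{w} A).obj Y) :
    Cocone (CostructuredArrow.proj yoneda X ⋙ A) where
  pt := Y
  ι :=
    { app j := restrictedShrinkYonedaEquiv (φ.app _ (yonedaEquiv j.hom))
      naturality j j' f := by
        have h : yonedaEquiv j.hom = X.map f.left.op (yonedaEquiv j'.hom) := by
          rw [yonedaEquiv_naturality]
          exact congrArg _ (CostructuredArrow.w f).symm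
        have h' := restrictedShrinkYonedaEquiv_app_map φ f.left (yonedaEquiv j'.hom)
        rw [← h] at h'
        exact h'.symm.trans (Category.comp_id _).symm }

/-- Morphisms from a pointwise left Kan extension along the Yoneda embedding correspond to
morphisms to a restricted Yoneda presheaf. -/
noncomputable def homEquivOfIsPointwiseLeftKanExtension (X : Cᵒᵖ ⥤ Type w) (Y : E) :
    (L.obj X ⟶ Y) ≃ (X ⟶ (restrictedShrinkYoneda.{w} A).obj Y) where
  toFun m :=
    { app c := ↾(fun a ↦ restrictedShrinkYonedaEquiv.symm
        (α.app c.unop ≫ L.map (yonedaEquiv.symm a) ≫ m))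
      naturality c c' u := by
        ext a
        apply restrictedShrinkYonedaEquiv.injective
        refine (Equiv.apply_symm_apply _ _).trans
          (Eq.trans ?_ (restrictedShrinkYonedaEquiv_map _ _).symm)
        refine Eq.trans ?_ (congrArg _ (Equiv.apply_symm_apply _ _).symm)
        change α.app _ ≫ L.map (yonedaEquiv.symm (X.map u a)) ≫ m = _
        rw [yonedaEquiv_symm_map]
        have := α.naturality u.unop
        dsimp at this
        rw [Functor.map_comp, Category.assoc]
        have h := congrArg (· ≫ L.map (yonedaEquiv.symm a) ≫ m) this
        simp only [Category.assoc] at h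
        exact h.symm }
  invFun φ := (hL X).desc (coconeOfHomRestrictedShrinkYoneda φ)
  left_inv m := by
    refine ((hL X).uniq (coconeOfHomRestrictedShrinkYoneda _) m fun j ↦ ?_).symm
    refine Eq.trans ?_ (Equiv.apply_symm_apply _ _).symm
    refine (Category.assoc _ _ _).trans ?_
    exact congrArg (fun f ↦ α.app j.left ≫ L.map f ≫ m)
      (Equiv.symm_apply_apply yonedaEquiv j.hom).symm
  right_inv φ := by
    ext ⟨c⟩ a
    apply restrictedShrinkYonedaEquiv.injective
    refine (Equiv.apply_symm_apply _ _).trans ?_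
    have := (hL X).fac (coconeOfHomRestrictedShrinkYoneda φ)
      (CostructuredArrow.mk (yonedaEquiv.symm a))
    refine (Category.assoc _ _ _).symm.trans (this.trans ?_)
    exact congrArg (fun b ↦ restrictedShrinkYonedaEquiv (φ.app (op c) b))
      (Equiv.apply_symm_apply _ _)

theorem homEquivOfIsPointwiseLeftKanExtension_app {X : Cᵒᵖ ⥤ Type w} {Y : E} (m : L.obj X ⟶ Y)
    {c : C} (a : X.obj (op c)) :
    restrictedShrinkYonedaEquiv ((homEquivOfIsPointwiseLeftKanExtension hL X Y m).app _ a) =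
      α.app c ≫ L.map (yonedaEquiv.symm a) ≫ m :=
  Equiv.apply_symm_apply _ _

/-- A pointwise left Kan extension along the Yoneda embedding is a left adjoint. -/
noncomputable def adjunctionOfIsPointwiseLeftKanExtension :
    L ⊣ restrictedShrinkYoneda.{w} A :=
  Adjunction.mkOfHomEquiv
    { homEquiv := homEquivOfIsPointwiseLeftKanExtension hL
      homEquiv_naturality_left_symm {X' X Y} f g := by
        obtain ⟨m, rfl⟩ := (homEquivOfIsPointwiseLeftKanExtension hL X Y).surjective g
        rw [Equiv.symm_apply_apply, Equiv.symm_apply_eq]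
        ext ⟨c⟩ a
        apply restrictedShrinkYonedaEquiv.injective
        refine (homEquivOfIsPointwiseLeftKanExtension_app hL m (f.app _ a)).trans
          (Eq.trans ?_ (homEquivOfIsPointwiseLeftKanExtension_app hL (L.map f ≫ m) a).symm)
        rw [← yonedaEquiv_symm_naturality_right, Functor.map_comp, Category.assoc]
      homEquiv_naturality_right {X Y Y'} m g := by
        ext ⟨c⟩ a
        apply restrictedShrinkYonedaEquiv.injective
        refine (homEquivOfIsPointwiseLeftKanExtension_app hL (m ≫ g) a).trans
          (Eq.trans ?_ (restrictedShrinkYonedaEquiv_app g _).symm)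
        refine Eq.trans ?_ (congrArg (· ≫ g) (homEquivOfIsPointwiseLeftKanExtension_app hL m a).symm)
        simp only [Category.assoc] }

end RightAdjoint

/-! ### Cover-distribution and the induced geometric morphism -/

section Extension

variable {C : Type u₁} [Category.{w} C] {D : Type u₂} [Category.{w} D]
  {J : GrothendieckTopology C} {K : GrothendieckTopology D} {H : Profunctor.{w} C D}
  {ι : Type w} {p : ι → C}

theorem IsCoverDistributing.locallyFactors (h : IsCoverDistributing J K H)
    (hp : ∀ c : C, Locally J c fun c' u ↦ ∃ (i : ι) (a : c' ⟶ p i) (b : p i ⟶ c), a ≫ b = u) :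
    LocallyFactors K H p := by
  intro c d x
  obtain ⟨S, hS, h'⟩ := hp c
  refine (Locally.of_mem (h x S hS)).mono ?_
  rintro d' v ⟨c', u, x', hu, hx'⟩
  obtain ⟨i, a, b, rfl⟩ := h' u hu
  exact ⟨i, b, (H.map a).app _ x', by rw [map_app_map_app, hx']⟩

/-- Injectivity holds because the relation only compares sections of `S` as arrows to `c`. For
surjectivity, cover-distribution for the pullback sieve of `S` along `u` locally moves a pair `(u,
x)` into `S`, and `hp` brings it back to the family `p`. -/
theorem W_tensor_map_functorInclusion (hH : IsCoverFlat K H) (hp : LocallyFactors K H p)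
    (h : IsCoverDistributing J K H) {c : C} (S : Sieve c) (hS : S ∈ J c) :
    K.W ((tensor p hH).map S.functorInclusion) := by
  apply W_of_locally_bijective
  · intro d x y hxy
    refine .of_forall fun d' v ↦ congrArg _ ?_
    obtain ⟨i, a, x, rfl⟩ := tensorMk_surjective x
    obtain ⟨j, b, y, rfl⟩ := tensorMk_surjective y
    rw [tensor_map_app_mk, tensor_map_app_mk, tensorMk_eq_iff] at hxy
    rw [tensorMk_eq_iff]
    refine Locally.mono hxy ?_
    rintro d' v ⟨e, u, u', z, h₁, h₂, h₃⟩
    exact ⟨e, u, u', z, Subtype.ext h₁, h₂, h₃⟩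
  · intro d z
    obtain ⟨i, u, x, rfl⟩ := tensorMk_surjective z
    refine (Locally.of_mem (h x (S.pullback u) (J.pullback_stable _ hS))).bind ?_
    rintro d₁ v₁ ⟨c', t, x', ht, hx'⟩
    refine (hp x').mono ?_
    rintro d₂ v₂ ⟨k, r, x'', hx''⟩
    have hm : S ((r ≫ t) ≫ u) := by
      simpa using S.downward_closed (show S (t ≫ u) from ht) r
    refine ⟨tensorMk p hH (X := S.functor) ⟨(r ≫ t) ≫ u, hm⟩ x'', ?_⟩
    change tensorMk p hH (X := yoneda.obj c) ((r ≫ t) ≫ u) x'' =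
      tensorMk p hH (X := yoneda.obj c) u ((H.obj _).map (v₂ ≫ v₁).op x)
    rw [tensorMk_eq_iff]
    have := LocallyRelated.of_map (K := K) (X := yoneda.obj c) u (r ≫ t) x''
    rw [← map_app_map_app, hx'', map_app_obj_map, hx', ← Functor.map_comp_apply, ← op_comp] at this
    exact this

end Extension

section InducedGeometricMorphism

variable {C : Type u₁} [Category.{w} C] {D : Type u₂} [Category.{w} D]
  {J : GrothendieckTopology C} {K : GrothendieckTopology D} [IsSmallGenerated K]
  {H : Profunctor.{w} C D} {ι : Type w} {p : ι → C}
  (hH : IsCoverFlat K H) (hp : LocallyFactors K H p) (hd : IsCoverDistributing J K H)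

include hH hp hd in
theorem isSheaf_restrictedShrinkYoneda (Y : Sheaf K (Type w)) :
    Presheaf.IsSheaf J
      ((restrictedShrinkYoneda.{w} (H ⋙ presheafToSheaf K (Type w))).obj Y) := by
  rw [isSheaf_iff_isSheaf_of_type]
  intro c S hS
  have : IsIso ((extension p hH).map S.functorInclusion) :=
    (K.W_iff _).1 (W_tensor_map_functorInclusion hH hp hd S hS)
  exact isSheafFor_of_isIso_map_functorInclusion (adjunctionOfIsPointwiseLeftKanExtension
    (isPointwiseLeftKanExtensionExtension hH hp)) S Y

/-- The geometric morphism induced by a distributor of sites. -/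
noncomputable def inducedGeometricMorphism : Geom J K where
  inverseImage := sheafToPresheaf J (Type w) ⋙ extension p hH
  directImage := ObjectProperty.lift _
    (restrictedShrinkYoneda.{w} (H ⋙ presheafToSheaf K (Type w)))
    (isSheaf_restrictedShrinkYoneda hH hp hd)
  adj := Adjunction.restrictFullyFaithful
    (adjunctionOfIsPointwiseLeftKanExtension (isPointwiseLeftKanExtensionExtension hH hp))
    (fullyFaithfulSheafToPresheaf J (Type w)) (Functor.FullyFaithful.id _)
    (Iso.refl _) (Iso.refl _)
  lex := by
    have : PreservesFiniteLimits (extension p hH) := preservesFiniteLimits_tensor_sheafify hH hp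
    infer_instance

variable [HasSheafify J (Type w)]

/-- The inverse image of the induced geometric morphism extends the extension of `H` to
presheaves. -/
noncomputable def extensionIso :
    extension p hH ≅ presheafToSheaf J (Type w) ⋙
      (inducedGeometricMorphism hH hp hd).inverseImage :=
  -- Both functors are left adjoint to the restricted Yoneda functor: the direct image followed by
  -- the inclusion of sheaves is that functor by definition.
  Adjunction.leftAdjointUniq
    (adjunctionOfIsPointwiseLeftKanExtension (isPointwiseLeftKanExtensionExtension hH hp))
    (((sheafificationAdjunction J (Type w)).comp
      (inducedGeometricMorphism hH hp hd).adj).ofNatIsoRight (Iso.refl _))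

end InducedGeometricMorphism

section

variable {C : Type u₁} [Category.{w} C] {D : Type u₂} [Category.{w} D]
  {J : GrothendieckTopology C} {K : GrothendieckTopology D} [IsSmallGenerated J]
  [IsSmallGenerated K]

theorem exists_geometricMorphism (H : DistributorOfSites J K) :
    ∃ (f : Geom J K) (α : (sheafifiedDistributor J K).obj H ⟶
      yoneda ⋙ (presheafInverseImage J K).obj f),
      Nonempty (Functor.LeftExtension.mk _ α).IsPointwiseLeftKanExtension := by
  obtain ⟨ι, p, h⟩ := IsSmallGenerated.exists_family J
  have hp := H.property.1.locallyFactors h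
  refine ⟨inducedGeometricMorphism H.property.2 hp H.property.1,
    extensionUnit H.property.2 hp ≫
      Functor.whiskerLeft yoneda (extensionIso H.property.2 hp H.property.1).hom, ⟨?_⟩⟩
  refine Functor.LeftExtension.isPointwiseLeftKanExtensionEquivOfIso
    (StructuredArrow.isoMk (extensionIso H.property.2 hp H.property.1) rfl)
    (isPointwiseLeftKanExtensionExtension H.property.2 hp)

end

/-! ### From geometric morphisms to distributors of sites -/

section GeneratedByRepresentables

variable {C : Type u₁} [Category.{w} C] {D : Type u₂} [Category.{w} D]
  {K : GrothendieckTopology D} (G : (Cᵒᵖ ⥤ Type w) ⥤ Sheaf K (Type w))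

/-- The subsheaf of sections of `G X` which locally come from representables over `X`. -/
def representableSections (X : Cᵒᵖ ⥤ Type w) : Subfunctor (G.obj X).obj where
  obj d := { z | Locally K d.unop fun d' v ↦ ∃ (c : C) (f : yoneda.obj c ⟶ X)
    (x : (G.obj (yoneda.obj c)).obj.obj (op d')),
      (G.map f).hom.app _ x = (G.obj X).obj.map v.op z }
  map {d d'} v z hz := by
    refine (Locally.pullback hz v.unop).mono ?_
    rintro d'' v' ⟨c, f, x, h⟩
    exact ⟨c, f, x, by simpa using h⟩

theorem isSheaf_representableSections (X : Cᵒᵖ ⥤ Type w) :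
    Presheaf.IsSheaf K (representableSections G X).toFunctor := by
  rw [isSheaf_iff_isSheaf_of_type, Subfunctor.isSheaf_iff _ (isSheaf_sheaf _)]
  intro d z hz
  refine (Locally.of_mem hz).bind ?_
  intro d' v hv
  refine Locally.mono hv ?_
  rintro d'' v' ⟨c, f, x, h⟩
  exact ⟨c, f, x, by simpa using h⟩

/-- Sections of `G X` locally come from representables over `X`, if `G` preserves colimits. -/
theorem locally_exists_representable [G.IsLeftAdjoint] {X : Cᵒᵖ ⥤ Type w} {d : D}
    (z : (G.obj X).obj.obj (op d)) : Locally K d fun d' v ↦ ∃ (c : C) (f : yoneda.obj c ⟶ X)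
      (x : (G.obj (yoneda.obj c)).obj.obj (op d')),
        (G.map f).hom.app _ x = (G.obj X).obj.map v.op z := by
  let Z : Sheaf K (Type w) := ⟨_, isSheaf_representableSections G X⟩
  let m : Z ⟶ G.obj X := ⟨(representableSections G X).ι⟩
  have hl {c : C} (f : yoneda.obj c ⟶ X) : ∃ l : G.obj (yoneda.obj c) ⟶ Z, l ≫ m = G.map f := by
    refine ⟨⟨Subfunctor.lift (G.map f).hom ?_⟩, ?_⟩
    · rintro ⟨d⟩ _ ⟨x, rfl⟩
      exact .of_forall fun d' v ↦ ⟨c, f, _, NatTrans.naturality_apply (G.map f).hom v.op x⟩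
    · rfl
  have hm : Mono m := (sheafToPresheaf K (Type w)).mono_of_mono_map
    (inferInstanceAs (Mono (representableSections G X).ι))
  choose l hl using @hl
  have hG := isColimitOfPreserves G (Presheaf.isColimitTautologicalCocone X)
  let s : Cocone ((CostructuredArrow.proj yoneda X ⋙ yoneda) ⋙ G) :=
    { pt := Z
      ι :=
        { app j := l j.hom
          naturality j j' f := by
            refine Eq.trans ?_ (Category.comp_id _).symm
            rw [← cancel_mono m]
            refine (Category.assoc _ _ _).trans ((congrArg _ (hl _)).trans (Eq.trans ?_ (hl _).symm))
            refine (G.map_comp _ _).symm.trans (congrArg G.map ?_)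
            exact CostructuredArrow.w f } }
  -- `G X` is the colimit of the `G(y(c))` over `X`, all of which map into the subsheaf `Z`; hence
  -- the inclusion `m` of `Z` has a section, and every section of `G X` lies in `Z`.
  have key : hG.desc s ≫ m = 𝟙 _ := hG.hom_ext fun j ↦ by
    rw [hG.fac_assoc]
    exact (hl j.hom).trans (Category.comp_id _).symm
  have h : ((hG.desc s).hom.app _ z).1 = z := congr(($key).hom.app _ z)
  have h' := ((hG.desc s).hom.app _ z).2
  rwa [h] at h'

variable {G} {J : GrothendieckTopology C}

/-- Transport `x` to a section of `G(S)` along the inverse isomorphism. It comes locally from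
morphisms `y(c') ⟶ S`, that is, from arrows of `S`. -/
theorem isCoverDistributing_of_isIso_map [G.IsLeftAdjoint]
    (hG : ∀ ⦃c : C⦄ (S : Sieve c), S ∈ J c → IsIso (G.map S.functorInclusion)) :
    IsCoverDistributing J K (yoneda ⋙ G ⋙ sheafToPresheaf K (Type w)) := by
  intro c d x S hS
  have := hG S hS
  change (G.obj (yoneda.obj c)).obj.obj (op d) at x
  apply Locally.mem
  refine (locally_exists_representable G ((inv (G.map S.functorInclusion)).hom.app _ x)).mono ?_
  rintro d' v ⟨c', g, x', h⟩
  have e : inv (G.map S.functorInclusion) ≫ G.map S.functorInclusion = 𝟙 _ := by simp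
  have e' : (G.map S.functorInclusion).hom.app _ ((inv (G.map S.functorInclusion)).hom.app _ x) =
    x := congr(($e).hom.app _ x)
  refine ⟨c', yoneda.preimage (g ≫ S.functorInclusion), x', ?_, ?_⟩
  · have h₁ : yoneda.preimage (g ≫ S.functorInclusion) = (yonedaEquiv g).1 :=
      yoneda.map_injective (by
        apply yonedaEquiv.injective
        rw [yoneda.map_preimage, yonedaEquiv_comp, yonedaEquiv_yoneda_map]
        rfl)
    rw [h₁]
    exact (yonedaEquiv g).2
  · change (G.map (yoneda.map (yoneda.preimage (g ≫ S.functorInclusion)))).hom.app _ x' =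
      (G.obj (yoneda.obj c)).obj.map v.op x
    rw [yoneda.map_preimage, G.map_comp]
    change (G.map S.functorInclusion).hom.app _ ((G.map g).hom.app _ x') = _
    rw [h, NatTrans.naturality_apply, e']

theorem exists_section_of_fork {Y Y' : Dᵒᵖ ⥤ Type w} {f g : Y ⟶ Y'} {s : Fork f g}
    (hs : IsLimit s) {d : D} (x : Y.obj (op d)) (h : f.app _ x = g.app _ x) :
    ∃ z : s.pt.obj (op d), s.ι.app _ z = x := by
  refine ⟨yonedaEquiv (Fork.IsLimit.lift hs (yonedaEquiv.symm x) ?_), ?_⟩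
  · rw [yonedaEquiv_symm_naturality_right, yonedaEquiv_symm_naturality_right, h]
  · rw [← yonedaEquiv_comp, Fork.IsLimit.lift_ι', Equiv.apply_symm_apply]

/-- In each axiom the data form a section of `G` at a finite limit of representables: the terminal
presheaf, a product (as a pullback over it), or an equalizer. Covering this section by
representables over the limit yields the required arrows of `C`. -/
theorem isCoverFlat_of_preservesFiniteLimits [G.IsLeftAdjoint] [PreservesFiniteLimits G] :
    IsCoverFlat K (yoneda ⋙ G ⋙ sheafToPresheaf K (Type w)) where
  support_mem d := by
    have hT := IsTerminal.isTerminalObj (G ⋙ sheafToPresheaf K (Type w)) _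
      (terminalIsTerminal (C := Cᵒᵖ ⥤ Type w))
    obtain ⟨z⟩ := nonempty_section_of_isTerminal hT d
    apply Locally.mem
    refine (locally_exists_representable G z).mono ?_
    rintro d' v ⟨c, -, x, -⟩
    exact ⟨c, ⟨x⟩⟩
  span_mem c c' d x x' := by
    have hT := IsTerminal.isTerminalObj (G ⋙ sheafToPresheaf K (Type w)) _
      (terminalIsTerminal (C := Cᵒᵖ ⥤ Type w))
    have sq := IsPullback.of_hasPullback (terminal.from (yoneda.obj c))
      (terminal.from (yoneda.obj c'))
    obtain ⟨z, hz, hz'⟩ := exists_section_of_isPullback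
      (sq.map (G ⋙ sheafToPresheaf K (Type w))) x x'
      ((subsingleton_section_of_isTerminal hT d).elim _ _)
    apply Locally.mem
    refine (locally_exists_representable G z).mono ?_
    rintro d' v ⟨c'', g, x'', h⟩
    refine ⟨c'', yoneda.preimage (g ≫ pullback.fst _ _),
      yoneda.preimage (g ≫ pullback.snd _ _), x'', ?_, ?_⟩
    · change (G.map (yoneda.map (yoneda.preimage (g ≫ pullback.fst _ _)))).hom.app _ x'' =
        (G.obj (yoneda.obj c)).obj.map v.op x
      rw [yoneda.map_preimage, G.map_comp]
      change (G.map (pullback.fst _ _)).hom.app _ ((G.map g).hom.app _ x'') = _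
      rw [h, NatTrans.naturality_apply]
      exact congrArg _ hz
    · change (G.map (yoneda.map (yoneda.preimage (g ≫ pullback.snd _ _)))).hom.app _ x'' =
        (G.obj (yoneda.obj c')).obj.map v.op x'
      rw [yoneda.map_preimage, G.map_comp]
      change (G.map (pullback.snd _ _)).hom.app _ ((G.map g).hom.app _ x'') = _
      rw [h, NatTrans.naturality_apply]
      exact congrArg _ hz'
  fork_mem c c' u u' d x hx := by
    have hE := isLimitForkMapOfIsLimit (G ⋙ sheafToPresheaf K (Type w)) _
      (equalizerIsEqualizer (yoneda.map u) (yoneda.map u'))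
    obtain ⟨z, hz⟩ := exists_section_of_fork hE x hx
    change (G.obj (equalizer (yoneda.map u) (yoneda.map u'))).obj.obj (op d) at z
    apply Locally.mem
    refine (locally_exists_representable G z).mono ?_
    rintro d' v ⟨c'', g, x'', h⟩
    refine ⟨c'', yoneda.preimage (g ≫ equalizer.ι _ _), x'', ?_, ?_⟩
    · apply yoneda.map_injective
      rw [yoneda.map_comp, yoneda.map_comp, yoneda.map_preimage, Category.assoc, Category.assoc,
        equalizer.condition]
    · change (G.map (yoneda.map (yoneda.preimage (g ≫ equalizer.ι _ _)))).hom.app _ x'' =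
        (G.obj (yoneda.obj c')).obj.map v.op x
      rw [yoneda.map_preimage, G.map_comp]
      change (G.map (equalizer.ι _ _)).hom.app _ ((G.map g).hom.app _ x'') = _
      rw [h, NatTrans.naturality_apply]
      exact congrArg _ hz

theorem W_functorInclusion {c : C} (S : Sieve c) (hS : S ∈ J c) : J.W S.functorInclusion := by
  intro Y hY
  rw [isSheaf_iff_isSheaf_of_type] at hY
  rw [Function.bijective_iff_existsUnique]
  exact Presieve.isSheafFor_iff_yonedaSheafCondition.1 (hY S hS)

end GeneratedByRepresentables

section

variable {C : Type u₁} [Category.{w} C] {D : Type u₂} [Category.{w} D]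
  {J : GrothendieckTopology C} {K : GrothendieckTopology D} [HasSheafify J (Type w)]

instance isLeftAdjoint_presheafInverseImage (f : Geom J K) :
    ((presheafInverseImage J K).obj f).IsLeftAdjoint :=
  ((sheafificationAdjunction J (Type w)).comp f.adj).isLeftAdjoint

instance preservesFiniteLimits_presheafInverseImage (f : Geom J K) :
    PreservesFiniteLimits ((presheafInverseImage J K).obj f) :=
  have := f.lex
  inferInstanceAs (PreservesFiniteLimits (presheafToSheaf J (Type w) ⋙ f.inverseImage))

theorem isDistributorOfSites_distributorOfGeom (f : Geom J K) :
    isDistributorOfSites J K ((distributorOfGeom J K).obj f) := by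
  refine ⟨isCoverDistributing_of_isIso_map (G := (presheafInverseImage J K).obj f) ?_,
    isCoverFlat_of_preservesFiniteLimits (G := (presheafInverseImage J K).obj f)⟩
  intro c S hS
  have : IsIso ((presheafToSheaf J (Type w)).map S.functorInclusion) :=
    (J.W_iff _).1 (W_functorInclusion S hS)
  exact inferInstanceAs (IsIso (f.inverseImage.map
    ((presheafToSheaf J (Type w)).map S.functorInclusion)))

end

/-! ### Left adjoints and Kan extensions -/

section LeftAdjoints

universe v₁' v₂' v₃' v₄' u₁' u₂' u₃' u₄'

variable {C₁ : Type u₁'} [Category.{v₁'} C₁] {C₂ : Type u₂'} [Category.{v₂'} C₂]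
  {B : Type u₃'} [Category.{v₃'} B] {E : Type u₄'} [Category.{v₄'} E]

/-- Left adjoints preserve left Kan extensions. -/
theorem isLeftKanExtension_whiskerRight_of_adjunction {F : B ⥤ E} {G : E ⥤ B} (adj : F ⊣ G)
    {y : C₁ ⥤ C₂} {A : C₁ ⥤ B} (L : C₂ ⥤ B) (α : A ⟶ y ⋙ L) [L.IsLeftKanExtension α] :
    (L ⋙ F).IsLeftKanExtension (L := y) (F := A ⋙ F) (Functor.whiskerRight α F) := by
  -- The universal property is transposed across `F ⊣ G`, so no pointwise hypothesis on the
  -- extension is needed.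
  let β (Z : y.LeftExtension (A ⋙ F)) : A ⟶ y ⋙ Z.right ⋙ G :=
    { app c := adj.homEquiv _ _ (Z.hom.app c)
      naturality c c' f := by
        refine (adj.homEquiv_naturality_left _ _).symm.trans
          ((congrArg _ (Z.hom.naturality f)).trans (adj.homEquiv_naturality_right _ _)) }
  let γ (Z : y.LeftExtension (A ⋙ F)) : L ⋙ F ⟶ Z.right :=
    { app X := (adj.homEquiv _ _).symm ((L.descOfIsLeftKanExtension α _ (β Z)).app X)
      naturality X X' f := by
        refine (adj.homEquiv_naturality_left_symm _ _).symm.trans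
          ((congrArg _ ((L.descOfIsLeftKanExtension α _ (β Z)).naturality f)).trans
            (adj.homEquiv_naturality_right_symm _ _)) }
  refine ⟨⟨IsInitial.ofUniqueHom (fun Z ↦ StructuredArrow.homMk (γ Z) ?_) fun Z m ↦ ?_⟩⟩
  · ext c
    apply (adj.homEquiv _ _).injective
    refine (adj.homEquiv_naturality_left _ _).trans ?_
    refine (congrArg _ (Equiv.apply_symm_apply _ _)).trans ?_
    exact L.descOfIsLeftKanExtension_fac_app α _ (β Z) c
  · apply StructuredArrow.ext
    ext X
    apply (adj.homEquiv _ _).injective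
    refine Eq.trans ?_ (Equiv.apply_symm_apply _ _).symm
    let δ : L ⟶ Z.right ⋙ G :=
      { app X := adj.homEquiv _ _ (m.right.app X)
        naturality X X' f := by
          refine (adj.homEquiv_naturality_left _ _).symm.trans
            ((congrArg _ (m.right.naturality f)).trans (adj.homEquiv_naturality_right _ _)) }
    have : δ = L.descOfIsLeftKanExtension α _ (β Z) := by
      apply L.hom_ext_of_isLeftKanExtension α
      rw [Functor.descOfIsLeftKanExtension_fac]
      ext c
      refine (adj.homEquiv_naturality_left _ _).symm.trans (congrArg _ ?_)
      exact congr(($(StructuredArrow.w m)).app c)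
    exact congr(($this).app X)

variable {C : Type u₁} [Category.{w} C]

/-- A left adjoint functor on presheaves is the left Kan extension of its restriction along the
Yoneda embedding. -/
theorem isLeftKanExtension_id_of_isLeftAdjoint (G : (Cᵒᵖ ⥤ Type w) ⥤ E) [G.IsLeftAdjoint] :
    G.IsLeftKanExtension (𝟙 (yoneda ⋙ G)) := by
  have h : (Functor.LeftExtension.mk G (𝟙 (yoneda ⋙ G))).IsPointwiseLeftKanExtension := fun X ↦
    IsColimit.ofIsoColimit (isColimitOfPreserves G (Presheaf.isColimitTautologicalCocone X))
      (Cocone.ext (Iso.refl _)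
        fun j ↦ (Category.comp_id _).trans (Category.id_comp (G.map j.hom)).symm)
  exact h.isLeftKanExtension

end LeftAdjoints

/-! ### Full faithfulness and the Hom bijection -/

section Main

variable {C : Type u₁} [Category.{w} C] {D : Type u₂} [Category.{w} D]
  {J : GrothendieckTopology C} {K : GrothendieckTopology D} [HasSheafify J (Type w)]

instance : (inverseImageFunctor (E := Sheaf K (Type w)) (F := Sheaf J (Type w))).Full where
  map_surjective φ := ⟨φ, rfl⟩

instance : (inverseImageFunctor (E := Sheaf K (Type w)) (F := Sheaf J (Type w))).Faithful where
  map_injective h := h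

instance : (presheafInverseImage J K).Full :=
  -- Sheafification is the localization of presheaves at `J.W`, so precomposing with it is fully
  -- faithful.
  have := Localization.full_whiskeringLeft (presheafToSheaf J (Type w)) J.W (Sheaf K (Type w))
  inferInstanceAs (inverseImageFunctor ⋙ _).Full

instance : (presheafInverseImage J K).Faithful :=
  have := Localization.faithful_whiskeringLeft (presheafToSheaf J (Type w)) J.W (Sheaf K (Type w))
  inferInstanceAs (inverseImageFunctor ⋙ _).Faithful

instance faithful_distributorOfGeom : (distributorOfGeom J K).Faithful where
  map_injective {f g} φ ψ h := by
    apply (presheafInverseImage J K).map_injective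
    have := isLeftKanExtension_id_of_isLeftAdjoint ((presheafInverseImage J K).obj f)
    apply Functor.hom_ext_of_isLeftKanExtension _ (𝟙 (yoneda ⋙ (presheafInverseImage J K).obj f))
    rw [Category.id_comp, Category.id_comp]
    ext c : 2
    exact (sheafToPresheaf K (Type w)).map_injective congr(($h).app c)

/-- A transformation `H_f ⟶ H_g` lifts to sheaves, extends along `y` by the Kan property of `f^*
a_J`, and descends along `a_J`. -/
instance full_distributorOfGeom : (distributorOfGeom J K).Full where
  map_surjective {f g} τ := by
    have := isLeftKanExtension_id_of_isLeftAdjoint ((presheafInverseImage J K).obj f)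
    let τ' : yoneda ⋙ (presheafInverseImage J K).obj f ⟶
        yoneda ⋙ (presheafInverseImage J K).obj g :=
      { app c := ⟨τ.app c⟩
        naturality c c' u := (sheafToPresheaf K (Type w)).map_injective (τ.naturality u) }
    obtain ⟨φ, hφ⟩ := (presheafInverseImage J K).map_surjective
      (Functor.descOfIsLeftKanExtension _ (𝟙 (yoneda ⋙ (presheafInverseImage J K).obj f)) _ τ')
    refine ⟨φ, ?_⟩
    have h := Functor.descOfIsLeftKanExtension_fac _
      (𝟙 (yoneda ⋙ (presheafInverseImage J K).obj f)) _ τ'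
    rw [← hφ, Category.id_comp] at h
    ext c : 2
    exact congrArg (sheafToPresheaf K (Type w)).map congr(($h).app c)

variable [HasSheafify K (Type w)]
  (hH : ∀ f : Geom J K, isDistributorOfSites J K ((distributorOfGeom J K).obj f))

/-- Transformations from a geometric morphism which extends `H` correspond to transformations
from `H`. -/
noncomputable def geomHomEquiv (H : DistributorOfSites J K) {f : Geom J K}
    (α : (sheafifiedDistributor J K).obj H ⟶ yoneda ⋙ (presheafInverseImage J K).obj f)
    [((presheafInverseImage J K).obj f).IsLeftKanExtension α] (g : Geom J K) :
    (f ⟶ g) ≃ (H ⟶ (functorH J K hH).obj g) :=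
  (Functor.FullyFaithful.ofFullyFaithful (presheafInverseImage J K)).homEquiv.trans <|
    (Functor.homEquivOfIsLeftKanExtension _ α _).trans <|
      (((sheafificationAdjunction K (Type w)).whiskerRight C).homEquiv H.obj
        (yoneda ⋙ (presheafInverseImage J K).obj g)).trans
          ((isDistributorOfSites J K).fullyFaithfulι.homEquiv (X := H)
            (Y := (functorH J K hH).obj g)).symm

theorem geomHomEquiv_hom_app (H : DistributorOfSites J K) {f : Geom J K}
    (α : (sheafifiedDistributor J K).obj H ⟶ yoneda ⋙ (presheafInverseImage J K).obj f)
    [((presheafInverseImage J K).obj f).IsLeftKanExtension α] {g : Geom J K} (φ : f ⟶ g) (c : C) :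
    (geomHomEquiv hH H α g φ).hom.app c =
      (sheafificationAdjunction K (Type w)).homEquiv _ _
        (α.app c ≫ ((presheafInverseImage J K).map φ).app (yoneda.obj c)) := by
  rw [Adjunction.homEquiv_unit]
  rfl

end Main

/-! ### The functor `Sh` and its adjunction -/

section Extend

variable {C : Type u₁} [Category.{w} C] {D : Type u₂} [Category.{w} D]
  (J : GrothendieckTopology C) (K : GrothendieckTopology D) [HasSheafify J (Type w)]
  [HasSheafify K (Type w)]

/-- A choice, for each distributor of sites, of a geometric morphism which extends it. -/
structure ExtensionData where
  /-- the geometric morphism -/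
  geom : DistributorOfSites J K → Geom J K
  /-- the unit of the extension -/
  unit (H : DistributorOfSites J K) : (sheafifiedDistributor J K).obj H ⟶
    yoneda ⋙ (presheafInverseImage J K).obj (geom H)
  /-- the extension is a pointwise left Kan extension -/
  isPointwise (H : DistributorOfSites J K) :
    (Functor.LeftExtension.mk _ (unit H)).IsPointwiseLeftKanExtension

variable {J K}

namespace ExtensionData

variable (e : ExtensionData J K)

instance isLeftKanExtension (H : DistributorOfSites J K) :
    ((presheafInverseImage J K).obj (e.geom H)).IsLeftKanExtension (e.unit H) :=
  (e.isPointwise H).isLeftKanExtension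

variable (hH : ∀ f : Geom J K, isDistributorOfSites J K ((distributorOfGeom J K).obj f))

/-- Naturality in the target is what makes the chosen objects assemble into a left adjoint functor.
-/
theorem geomHomEquiv_comp (H : DistributorOfSites J K) {g g' : Geom J K} (φ : e.geom H ⟶ g)
    (ψ : g ⟶ g') : geomHomEquiv hH H (e.unit H) g' (φ ≫ ψ) =
      geomHomEquiv hH H (e.unit H) g φ ≫ (functorH J K hH).map ψ := by
  apply (isDistributorOfSites J K).ι.map_injective
  ext c : 2
  refine (geomHomEquiv_hom_app hH H (e.unit H) (φ ≫ ψ) c).trans ?_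
  have h : (e.unit H).app c ≫ ((presheafInverseImage J K).map (φ ≫ ψ)).app (yoneda.obj c) =
      ((e.unit H).app c ≫ ((presheafInverseImage J K).map φ).app (yoneda.obj c)) ≫
        ((presheafInverseImage J K).map ψ).app (yoneda.obj c) := by
    rw [Functor.map_comp, NatTrans.comp_app]
    exact (Category.assoc _ _ _).symm
  refine (congrArg ((sheafificationAdjunction K (Type w)).homEquiv _ _) h).trans ?_
  exact (Adjunction.homEquiv_naturality_right _ _ _).trans
    (congrArg (· ≫ _) (geomHomEquiv_hom_app hH H (e.unit H) φ c).symm)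

/-- The functor from distributors of sites to geometric morphisms. -/
noncomputable def functorSh : DistributorOfSites J K ⥤ Geom J K :=
  Adjunction.leftAdjointOfEquiv (G := functorH J K hH)
    (fun H g ↦ geomHomEquiv hH H (e.unit H) g) (fun H _ _ ψ φ ↦ e.geomHomEquiv_comp hH H φ ψ)

/-- The functor from distributors of sites to geometric morphisms is left adjoint to `ℍ`. -/
noncomputable def adjunction : e.functorSh hH ⊣ functorH J K hH :=
  Adjunction.adjunctionOfEquivLeft _ _

theorem geomHomEquiv_functorSh_map {H H' : DistributorOfSites J K} (τ : H ⟶ H') :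
    geomHomEquiv hH H (e.unit H) _ ((e.functorSh hH).map τ) =
      τ ≫ geomHomEquiv hH H' (e.unit H') _ (𝟙 _) :=
  Equiv.apply_symm_apply _ _

/-- The units of the extensions are natural. -/
noncomputable def unitTrans : sheafifiedDistributor J K ⟶
    e.functorSh hH ⋙ presheafInverseImage J K ⋙ (Functor.whiskeringLeft _ _ _).obj yoneda where
  app H := e.unit H
  naturality H H' τ := by
    ext c : 2
    -- After transposition, naturality of the units becomes the equation defining `functorSh` on
    -- morphisms.
    apply ((sheafificationAdjunction K (Type w)).homEquiv _ _).injective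
    refine (Adjunction.homEquiv_naturality_left _ _ _).trans ?_
    have h := congr(($(e.geomHomEquiv_functorSh_map hH τ)).hom.app c)
    refine Eq.trans ?_ (h.symm.trans (geomHomEquiv_hom_app hH H (e.unit H) _ c))
    refine congrArg (τ.hom.app c ≫ ·) (Eq.trans ?_
      (geomHomEquiv_hom_app hH H' (e.unit H') (𝟙 _) c).symm)
    refine congrArg _ (Eq.trans ?_ (congrArg (fun m ↦ (e.unit H').app c ≫ m.app (yoneda.obj c))
      ((presheafInverseImage J K).map_id (e.geom H')).symm))
    exact (Category.comp_id _).symm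

theorem isExtensionFunctor : IsExtensionFunctor J K (e.functorSh hH) (e.unitTrans hH) where
  pointwise H := ⟨e.isPointwise H⟩
  lext H L α hL := by
    let β : (sheafifiedDistributor J K).obj H ⟶ yoneda ⋙ (L ⋙ presheafToSheaf K (Type w)) :=
      Functor.whiskerRight α (presheafToSheaf K (Type w))
    -- Being a left adjoint, `a_K` preserves the Kan extension `L`; uniqueness then compares it with
    -- the chosen one, compatibly with the units.
    have : Functor.IsLeftKanExtension _ β := isLeftKanExtension_whiskerRight_of_adjunction
      (sheafificationAdjunction K (Type w)) L α
    let i : L ⋙ presheafToSheaf K (Type w) ≅ (presheafInverseImage J K).obj (e.geom H) :=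
      Functor.leftKanExtensionUnique _ β _ (e.unit H)
    refine ⟨⟨i, ?_⟩, ⟨?_⟩⟩
    · exact (Functor.descOfIsLeftKanExtension_fac _ β _ _).trans
        (Category.id_comp (e.unit H))
    -- Restricting to sheaves cancels `a_J` because the counit `a_J i_J ⟶ 𝟙` is invertible.
    · exact Functor.isoWhiskerLeft (sheafToPresheaf J (Type w)) i ≪≫
        (Functor.associator _ _ _).symm ≪≫
        Functor.isoWhiskerRight (asIso (sheafificationAdjunction J (Type w)).counit) _ ≪≫
        Functor.leftUnitor _

end ExtensionData

end Extend

end SiteDist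

theorem mainTheorem2 {C : Type u₁} [Category.{w} C] {D : Type u₂} [Category.{w} D]
    (J : GrothendieckTopology C) (K : GrothendieckTopology D)
    [SiteDist.IsSmallGenerated J] [SiteDist.IsSmallGenerated K] :
    ∃ hH : ∀ f : SiteDist.Geom J K,
        SiteDist.isDistributorOfSites J K ((SiteDist.distributorOfGeom J K).obj f),
      (SiteDist.functorH J K hH).Full ∧ (SiteDist.functorH J K hH).Faithful ∧
      ∃ (Sh : SiteDist.DistributorOfSites J K ⥤ SiteDist.Geom J K)
        (η : SiteDist.sheafifiedDistributor J K ⟶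
          Sh ⋙ SiteDist.presheafInverseImage J K ⋙
            (Functor.whiskeringLeft _ _ _).obj yoneda),
        SiteDist.IsExtensionFunctor J K Sh η ∧ Nonempty (Sh ⊣ SiteDist.functorH J K hH) := by
  have hH := SiteDist.isDistributorOfSites_distributorOfGeom (J := J) (K := K)
  choose geom unit isPointwise using SiteDist.exists_geometricMorphism (J := J) (K := K)
  let e : SiteDist.ExtensionData J K := ⟨geom, unit, fun H ↦ (isPointwise H).some⟩
  exact ⟨hH, inferInstanceAs (ObjectProperty.lift _ _ hH).Full,
    inferInstanceAs (ObjectProperty.lift _ _ hH).Faithful,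
    e.functorSh hH, e.unitTrans hH, e.isExtensionFunctor hH, ⟨e.adjunction hH⟩⟩
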